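/- **Setting.** Let $n\ge 2$ and let $B\subset\mathbb R^n$ be a bounded domain. For a unit vector $\xi\in\mathbb S^{n-1}$ choose spherical coordinates $\varphi_1,\dots,\varphi_{n-2}\in[0,\pi]$, $\varphi_{n-1}\in[0,2\pi)$, $$\xi=(\sin\varphi_1\cdots\sin\varphi_{n-1},\ \sin\varphi_1\cdots\sin\varphi_{n-2}\cos\varphi_{n-1},\ \dots,\ \sin\varphi_1\cos\varphi_2,\ \cos\varphi_1),$$ and let $\eta_1(\xi),\dots,\eta_{n-1}(\xi)$ be the associated orthonormal frame of $\xi^\perp$, where $\eta_i$ is the vector obtained from $\partial\xi/\partial\varphi_i$ by omitting the factors $\sin\varphi_1\cdots\sin\varphi_{i-1}$. For a vector field $f$ the transverse ray transforms are $$T_if(x,\xi)=\int_{\mathbb R}\langle f(x+t\xi),\eta_i(\xi)\rangle\,dt,\qquad i=1,\dots,n-1 .$$ Write $H_{\omega,p}=\{x:\langle\omega,x\rangle=p\}$ for $\omega\in\mathbb S^{n-1}$, $p\in\mathbb R$. Let $\gamma\subset\mathbb R^n$ be a curve (any subset of $\mathbb R^n$ is allowed) such that * $\gamma$ *encompasses*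 $B$: $\gamma\cap B=\emptyset$, and for all $a\in\gamma$, $\xi\ne0$, at most one of the rays $\{a+t\xi:t\ge0\}$, $\{a+t\xi:t\le0\}$ intersects $B$; * $\gamma$ satisfies the *modified Kirillov–Tuy condition*: for almost every hyperplane $H_{\omega,p}$ intersecting $B$ there are points $\gamma_1,\gamma_2\in H_{\omega,p}\cap\gamma$, depending locally smoothly on $(\omega,p)$, such that $x-\gamma_1$, $x-\gamma_2$ are linearly independent for almost every $x\in H_{\omega,p}\cap B$. (This is impossible for $n=2$, so that in fact $n\ge3$.) **Theorem.** 1. *(Uniqueness.)* If $f,g$ are $C^\infty$ vector fields on $\mathbb R^n$ with compact supports contained in $B$, and $T_if(a,\xi)=T_ig(a,\xi)$ for all $a\in\gamma$, $\xi\in\mathbb S^{n-1}$ and $1\le i\le n-1$, then $f=g$. 2. *(Reconstruction.)* There are functions $\gamma_1,\gamma_2:\mathbb S^{n-1}\times\mathbb R\to\gamma$ such that for almost every $(\omega,p)$ for which $H_{\omega,p}$ intersects $B$, the points $\gamma_j=\gamma_j(\omega,p)$ lie on $H_{\omega,p}$ and $x-\gamma_1$, $x-\gamma_2$ are linearly independent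 for almost every $x\in H_{\omega,p}\cap B$. Fix any such functions, and let $f$ be a $C^\infty$ vector field with compact support contained in $B$. For $a\in\gamma$ put $D(a,\xi)=\sum_iT_if(a,\xi)\,\eta_i(\xi)$ if $|\xi|=1$ and $\{a+t\xi:t\ge0\}$ intersects $B$, and $D(a,\xi)=0$ if $|\xi|=1$ and this ray misses $B$; extend $D(a,\cdot)$ to $\mathbb R^n\setminus\{0\}$ homogeneously of degree $-1$. Let $$k_a(\omega)=\int_{\theta\in\mathbb S^{n-1},\,\theta\perp\omega}\big(\omega\cdot\partial_\xi\big)^{n-1}\Big(\langle\omega,\xi\rangle D(a,\xi)-\langle\omega,D(a,\xi)\rangle\,\xi\Big)\Big|_{\xi=\theta}\,d\theta ,$$ $$W_0(\omega,p)=\frac{\langle k_{\gamma_1}(\omega)-k_{\gamma_2}(\omega),\,\gamma_1-\gamma_2\rangle}{|\gamma_1-\gamma_2|^2},\qquad W_v(\omega,p)=\langle k_{\gamma_1}(\omega)-W_0(\omega,p)\,\gamma_1,\,v\rangle\qquad(v\in\mathbb R^n)$$ if $H_{\omega,p}$ intersects $B$, and $W_0(\omega,p)=W_v(\omega,p)=0$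 otherwise. Let $\mathcal R^{-1}$ denote the Radon inversion of a function from the derivative of order $n-2$ in $p$ of its Radon transform, $$\mathcal R^{-1}G(x)=\operatorname{Re}\int_{\mathbb S^{n-1}}\int_0^\infty s^{n-1}e^{2\pi is\langle x,\omega\rangle}(2\pi is)^{-(n-2)}\int_{\mathbb R}e^{-2\pi isp}\,G(\omega,p)\,dp\,ds\,d\omega .$$ Then for all $x,v\in\mathbb R^n$ $$\langle f(x),v\rangle=\mathcal I_v(x):=\frac1{n-2}\Big(\mathcal R^{-1}W_v(x)+\langle x,v\rangle\,\mathcal R^{-1}W_0(x)\Big).$$ 3. *(Cramer's rule.)* With $\gamma_1,\gamma_2,f$ as in 2, let $x\in\mathbb R^n$ and let $\xi_1,\xi_2$ be linearly independent unit vectors. Then there is an $l\in\{1,\dots,n-1\}$ such that $w_i=\eta_i(\xi_1)$ $(1\le i\le n-1)$, $w_n=\eta_l(\xi_2)$ are linearly independent, and for every such $l$ and every $v\in\mathbb R^n$ $$\langle f(x),v\rangle=\sum_{i=1}^{n}\frac{\Delta_i(v)}{\Delta}\,\mathcal I_{w_i}(x),$$ where $\Delta=\det(w_1,\dots,w_n)$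 and $\Delta_i(v)$ is the same determinant with $w_i$ replaced by $v$. -/

import Mathlib

open MeasureTheory Set
open scoped RealInnerProductSpace

noncomputable section

/-- `ℝⁿ` with its Euclidean structure. -/
abbrev Rn (n : ℕ) : Type := EuclideanSpace ℝ (Fin n)

/-- The unit sphere `S^{n-1}` of `ℝⁿ`. -/
abbrev Sn (n : ℕ) : Type := Metric.sphere (0 : Rn n) 1

/-! ### Spherical coordinates and the associated orthonormal frame -/

/-- The last factor `cos φ_{r+1}` of the `r`-th coordinate counted from the bottom; it is absent in
the top coordinate `r = n - 1`.  (Angles are `φ_1, …, φ_{n-1}`, stored as `φ 0, …, φ (n-2)`.) -/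
def cosFactor {n : ℕ} (φ : Fin (n - 1) → ℝ) (r : ℕ) : ℝ :=
  if h : r < n - 1 then Real.cos (φ ⟨r, h⟩) else 1

/-- The point of the sphere with hyperspherical angles `φ`:
`(sin φ₁ ⋯ sin φ_{n-1}, sin φ₁ ⋯ sin φ_{n-2} cos φ_{n-1}, …, sin φ₁ cos φ₂, cos φ₁)`. The coordinate
`k` is the `r`-th one from the bottom, `r = n - 1 - k`. -/
def sphericalPoint {n : ℕ} (φ : Fin (n - 1) → ℝ) : Rn n :=
  WithLp.toLp 2 fun k : Fin n =>
    (∏ j : Fin (n - 1), if j.val < n - 1 - k.val then Real.sin (φ j) else 1) *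
      cosFactor φ (n - 1 - k.val)

/-- The frame vector `η_{i+1}` at the point with angles `φ`. With `r` counting the coordinates from
the bottom, its coordinates are `0` for `r < i`, `-sin φ_{i+1}` for `r = i`, and
`cos φ_{i+1} sin φ_{i+2} ⋯ sin φ_r · cos φ_{r+1}` (last factor absent on top) for `r > i`. -/
def frameVector {n : ℕ} (φ : Fin (n - 1) → ℝ) (i : Fin (n - 1)) : Rn n :=
  WithLp.toLp 2 fun k : Fin n =>
    if n - 1 - k.val < i.val then 0
    else if n - 1 - k.val = i.val then -Real.sin (φ i)
    else Real.cos (φ i) *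
      (∏ j : Fin (n - 1),
        if i.val < j.val ∧ j.val < n - 1 - k.val then Real.sin (φ j) else 1) *
      cosFactor φ (n - 1 - k.val)

/-- `φ` are spherical coordinates of `ξ`: `φ₁, …, φ_{n-2} ∈ [0, π]`, `φ_{n-1} ∈ [0, 2π)`. They are
unique except on a null set of directions `ξ`. -/
def IsSphericalCoordinates {n : ℕ} (ξ : Sn n) (φ : Fin (n - 1) → ℝ) : Prop :=
  (∀ j : Fin (n - 1), j.val + 1 < n - 1 → φ j ∈ Icc 0 Real.pi) ∧
  (∀ j : Fin (n - 1), j.val + 1 = n - 1 → φ j ∈ Ico 0 (2 * Real.pi)) ∧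
  sphericalPoint φ = (ξ : Rn n)

/-! ### The transverse ray transform -/

/-- `f ∈ C_c^∞` is a vector field with support in `B`. -/
structure IsSmoothFieldSupportedIn {n : ℕ} (f : Rn n → Rn n) (B : Set (Rn n)) : Prop where
  smooth : ContDiff ℝ (⊤ : ℕ∞) f
  compactSupport : HasCompactSupport f
  support_subset : tsupport f ⊆ B

/-- `T_{i+1} f (x, ξ) = ∫ ⟨f (x + t ξ), η_{i+1}⟩ dt`, where `η` is the frame at `ξ` given by the
chosen spherical coordinates `ang ξ` of `ξ`. -/
def transverseRay {n : ℕ} (ang : Sn n → Fin (n - 1) → ℝ) (f : Rn n → Rn n)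
    (x : Rn n) (ξ : Sn n) (i : Fin (n - 1)) : ℝ :=
  ∫ t : ℝ, ⟪f (x + t • (ξ : Rn n)), frameVector (ang ξ) i⟫

/-- The type of the restricted data: a number for each point of `γ`, each direction, each `i`. -/
abbrev RayData {n : ℕ} (γ : Set (Rn n)) : Type := γ → Sn n → Fin (n - 1) → ℝ

/-- The transverse ray transforms of `f` for all the lines that meet `γ`. -/
def restrictedData {n : ℕ} (γ : Set (Rn n)) (ang : Sn n → Fin (n - 1) → ℝ) (f : Rn n → Rn n) :
    RayData γ :=
  fun a ξ i => transverseRay ang f a ξ i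

/-! ### The conditions on the curve -/

/-- The hyperplane `H_{ω,p}`. -/
def hyperplane {n : ℕ} (ω : Rn n) (p : ℝ) : Set (Rn n) := {x | ⟪ω, x⟫ = p}

/-- The measure `dω dp` on `S^{n-1} × ℝ`, which parametrizes the hyperplanes. -/
def hyperplaneMeasure (n : ℕ) : Measure (Sn n × ℝ) :=
  ((volume : Measure (Rn n)).toSphere).prod volume

/-- For almost every `x ∈ H_{ω,p} ∩ B` (with respect to the `(n-1)`-dimensional volume of the
hyperplane) the vectors `x - a`, `x - b` are linearly independent. -/
def IndependentOnSlice {n : ℕ} (B : Set (Rn n)) (ω : Rn n) (p : ℝ) (a b : Rn n) : Prop :=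
  ∀ᵐ x ∂((Measure.euclideanHausdorffMeasure (n - 1) : Measure (Rn n)).restrict
    (hyperplane ω p ∩ B)), LinearIndependent ℝ ![x - a, x - b]

/-- The modified Kirillov–Tuy condition: for almost every hyperplane that intersects `B` there are
points `γ₁, γ₂ ∈ H_{ω,p} ∩ γ`, depending smoothly on `(ω, p)` locally, such that `x - γ₁`, `x - γ₂`
are linearly independent for almost every `x ∈ H_{ω,p} ∩ B`. -/
def ModifiedKirillovTuy {n : ℕ} (γ B : Set (Rn n)) : Prop :=
  ∀ᵐ h ∂(hyperplaneMeasure n), (hyperplane (h.1 : Rn n) h.2 ∩ B).Nonempty →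
    ∃ (U : Set (Rn n × ℝ)) (c₁ c₂ : Rn n × ℝ → Rn n),
      IsOpen U ∧ ((h.1 : Rn n), h.2) ∈ U ∧ ContDiffOn ℝ (⊤ : ℕ∞) c₁ U ∧ ContDiffOn ℝ (⊤ : ℕ∞) c₂ U ∧
      (∀ u ∈ U, ‖u.1‖ = 1 →
        c₁ u ∈ hyperplane u.1 u.2 ∩ γ ∧ c₂ u ∈ hyperplane u.1 u.2 ∩ γ) ∧
      IndependentOnSlice B h.1 h.2 (c₁ (h.1, h.2)) (c₂ (h.1, h.2))

/-- The closed ray `{a + t ξ : t ≥ 0}`. -/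
def closedRay {n : ℕ} (a ξ : Rn n) : Set (Rn n) := {x | ∃ t : ℝ, 0 ≤ t ∧ x = a + t • ξ}

/-- `γ` encompasses `B`: `γ ∩ B = ∅`, and for `a ∈ γ`, `ξ ≠ 0` at most one of the two rays
`{a + t ξ : t ≥ 0}`, `{a + t ξ : t ≤ 0}` intersects `B`. -/
def Encompasses {n : ℕ} (γ B : Set (Rn n)) : Prop :=
  γ ∩ B = ∅ ∧ ∀ a ∈ γ, ∀ ξ : Rn n, ξ ≠ 0 →
    ¬((closedRay a ξ ∩ B).Nonempty ∧ (closedRay a (-ξ) ∩ B).Nonempty)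

/-- A choice of points `γ₁(ω,p), γ₂(ω,p)` as in the modified Kirillov–Tuy condition (no smoothness
or measurability is asked of the choice). -/
def IsPointChoice {n : ℕ} (γ B : Set (Rn n)) (c₁ c₂ : Sn n × ℝ → γ) : Prop :=
  ∀ᵐ h ∂(hyperplaneMeasure n), (hyperplane (h.1 : Rn n) h.2 ∩ B).Nonempty →
    (c₁ h : Rn n) ∈ hyperplane (h.1 : Rn n) h.2 ∧ (c₂ h : Rn n) ∈ hyperplane (h.1 : Rn n) h.2 ∧
      IndependentOnSlice B h.1 h.2 (c₁ h) (c₂ h)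

/-! ### The explicit reconstruction -/

/-- The unit vector `ξ / |ξ|`. -/
def unitDirection {n : ℕ} (ξ : Rn n) (h : ξ ≠ 0) : Sn n :=
  ⟨‖ξ‖⁻¹ • ξ, by simp [norm_smul, h]⟩

open Classical in
/-- The vector `∑ i, T_i⁺ (a, ξ) η_i(ξ)` for `|ξ| = 1`, extended to all `ξ ≠ 0` as a homogeneous
function of degree `-1`. Here `T_i⁺`, the transform over the half-line `{a + t ξ : t ≥ 0}`, is the
datum `T_i` if this half-line intersects `B`, and `0` otherwise. -/
def halfLineField {n : ℕ} {γ : Set (Rn n)} (B : Set (Rn n)) (ang : Sn n → Fin (n - 1) → ℝ)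
    (T : RayData γ) (a : γ) (ξ : Rn n) : Rn n :=
  if h : ξ ≠ 0 then
    if (closedRay (a : Rn n) ξ ∩ B).Nonempty then
      ‖ξ‖⁻¹ • ∑ i, T a (unitDirection ξ h) i • frameVector (ang (unitDirection ξ h)) i
    else 0
  else 0

/-- With `D` the half-line field of the data, the vector
`k_a(ω) = ∫_{θ ∈ S^{n-1}, θ ⊥ ω} (ω · ∂_ξ)^{n-1} (⟨ω, ξ⟩ D(a, ξ) - ⟨ω, D(a, ξ)⟩ ξ) |_{ξ = θ} dθ`. -/
def coneVector {n : ℕ} {γ : Set (Rn n)} (B : Set (Rn n)) (ang : Sn n → Fin (n - 1) → ℝ)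
    (T : RayData γ) (a : γ) (ω : Sn n) : Rn n :=
  ∫ θ : Metric.sphere (0 : (ℝ ∙ (ω : Rn n))ᗮ) 1,
    iteratedDeriv (n - 1)
      (fun q : ℝ =>
        ⟪(ω : Rn n), ((θ : (ℝ ∙ (ω : Rn n))ᗮ) : Rn n) + q • (ω : Rn n)⟫ •
            halfLineField B ang T a (((θ : (ℝ ∙ (ω : Rn n))ᗮ) : Rn n) + q • (ω : Rn n)) -
          ⟪(ω : Rn n),
              halfLineField B ang T a (((θ : (ℝ ∙ (ω : Rn n))ᗮ) : Rn n) + q • (ω : Rn n))⟫ •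
            (((θ : (ℝ ∙ (ω : Rn n))ᗮ) : Rn n) + q • (ω : Rn n))) 0
    ∂((volume : Measure (ℝ ∙ (ω : Rn n))ᗮ).toSphere)

open Classical in
/-- The scalar `W₀(ω,p) = ⟨k_{γ₁}(ω) - k_{γ₂}(ω), γ₁ - γ₂⟩ / |γ₁ - γ₂|²`, where `γ_j = γ_j(ω,p)`;
it is `0` for hyperplanes that miss `B`. -/
def scalarWeight {n : ℕ} {γ : Set (Rn n)} (B : Set (Rn n)) (ang : Sn n → Fin (n - 1) → ℝ)
    (c₁ c₂ : Sn n × ℝ → γ) (T : RayData γ) (ω : Sn n) (p : ℝ) : ℝ :=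
  if (hyperplane (ω : Rn n) p ∩ B).Nonempty then
    ⟪coneVector B ang T (c₁ (ω, p)) ω - coneVector B ang T (c₂ (ω, p)) ω,
        (c₁ (ω, p) : Rn n) - (c₂ (ω, p) : Rn n)⟫ /
      ‖(c₁ (ω, p) : Rn n) - (c₂ (ω, p) : Rn n)‖ ^ 2
  else 0

open Classical in
/-- The scalar `W_v(ω,p) = ⟨k_{γ₁}(ω) - W₀(ω,p) γ₁, v⟩`, where `γ₁ = γ₁(ω,p)`; it is `0` for
hyperplanes that miss `B`. -/
def vectorWeight {n : ℕ} {γ : Set (Rn n)} (B : Set (Rn n)) (ang : Sn n → Fin (n - 1) → ℝ)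
    (c₁ c₂ : Sn n × ℝ → γ) (T : RayData γ) (v : Rn n) (ω : Sn n) (p : ℝ) : ℝ :=
  if (hyperplane (ω : Rn n) p ∩ B).Nonempty then
    ⟪coneVector B ang T (c₁ (ω, p)) ω -
        scalarWeight B ang c₁ c₂ T ω p • (c₁ (ω, p) : Rn n), v⟫
  else 0

/-- Radon inversion from the `k`-th derivative `G(ω,p) = ∂_p^k (R h)(ω,p)` of the Radon transform of
a function `h` on `ℝⁿ`, through the Fourier transform in `p`:
`h(x) = ∫_{S^{n-1}} ∫_0^∞ s^{n-1} e^{2πi s⟨x,ω⟩} (2πi s)^{-k} ∫_ℝ e^{-2πi s p} G(ω,p) dp ds dω`. -/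
def radonInversion {n : ℕ} (k : ℕ) (G : Sn n → ℝ → ℝ) (x : Rn n) : ℝ :=
  (∫ ω : Sn n, (∫ s in Ioi (0 : ℝ),
    (s : ℂ) ^ (n - 1) * Complex.exp (2 * Real.pi * Complex.I * s * (⟪x, (ω : Rn n)⟫ : ℝ)) *
      ((2 * Real.pi * Complex.I * s) ^ k)⁻¹ *
      (∫ p : ℝ, Complex.exp (-(2 * Real.pi * Complex.I * s * p)) * (G ω p : ℂ)))
    ∂((volume : Measure (Rn n)).toSphere)).re

/-- The value at `x` of the component along `v` of the unknown field, computed from the data `T`: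
`(R⁻¹ W_v (x) + ⟨x, v⟩ R⁻¹ W₀ (x)) / (n - 2)`, with Radon inversion from the derivative of order
`n - 2`. -/
def reconstructedComponent {n : ℕ} {γ : Set (Rn n)} (B : Set (Rn n))
    (ang : Sn n → Fin (n - 1) → ℝ) (c₁ c₂ : Sn n × ℝ → γ) (T : RayData γ)
    (v x : Rn n) : ℝ :=
  ((n : ℝ) - 2)⁻¹ *
    (radonInversion (n - 2) (vectorWeight B ang c₁ c₂ T v) x +
      ⟪x, v⟫ * radonInversion (n - 2) (scalarWeight B ang c₁ c₂ T) x)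

/-- The `n` vectors `(η₁)_1, …, (η₁)_{n-1}, (η₂)_l`: the frame at `ξ₁` and one vector of the frame
at `ξ₂`. -/
def mixedFrame {n : ℕ} (ang : Sn n → Fin (n - 1) → ℝ) (ξ₁ ξ₂ : Sn n) (l : Fin (n - 1))
    (j : Fin n) : Rn n :=
  if h : j.val < n - 1 then frameVector (ang ξ₁) ⟨j.val, h⟩ else frameVector (ang ξ₂) l

/-- The matrix with columns `w_1, …, w_n`. -/
def columnMatrix {n : ℕ} (w : Fin n → Rn n) : Matrix (Fin n) (Fin n) ℝ :=
  Matrix.of fun i j => w j i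

/-- Cramer's quotient `Δ_j(v) / Δ`: `Δ` is the determinant with columns `w_1, …, w_n`, and in
`Δ_j(v)` the column `w_j` is replaced by `v`. -/
def cramerCoefficient {n : ℕ} (w : Fin n → Rn n) (v : Rn n) (j : Fin n) : ℝ :=
  ((columnMatrix w).updateCol j (fun i => v i)).det / (columnMatrix w).det

end

/-!
The proof computes the vectors `k_a(ω)` explicitly and recognizes the two weights as derivatives,
in `p`, of Radon transforms of functions from which the field can be read off.

Put `X(ξ) = ∫_{t > 0} f(a + tξ) dt`. The frame at `ξ` is an orthonormal basis of `ξ^⊥`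
(`sum_inner_frameVector_smul`) and only one half of a line through `a ∈ γ` meets `B`, so the
half-line field `D(a, ξ)` is `X(ξ)` up to a multiple of `ξ` (`exists_halfLineField_eq`). Such a
multiple cancels in `⟨ω, ξ⟩ D - ⟨ω, D⟩ ξ`, which is therefore the cone integral
`∫ t⁻¹ Φ(a + tξ) dt` of `Φ(y) = ⟨ω, y - a⟩ f(y) - ⟨ω, f(y)⟩ (y - a)`
(`halfLineField_combination_eq`). A derivative of order `n - 1` in the direction `ω` brings out
the factor `t^{n-1}`; together with `t⁻¹` it is the polar density of the hyperplane through `a`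
orthogonal to `ω`, so `k_a(ω)` is the integral of `∂_ω^{n-1} Φ` over that hyperplane
(`IsTestFunction.integral_iteratedDeriv_cone`). There `⟨ω, y - a⟩` vanishes, and Leibniz' rule
gives `k_a(ω) = A(ω,p) + s(ω,p) a`, where `s = ∫_{H_{ω,p}} ∂_ω^{n-1} ⟨ω, f⟩` and `A` does not
depend on `a` (`coneVector_eq`). Hence two different points `a` on the same hyperplane determine
`W₀ = s` and `W_v = ⟨A, v⟩`.

On the Fourier side, with `ω`-derivatives becoming powers of `2πis` and `2πis ⟨ω, f̂(sω)⟩` being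
the Fourier transform of `div f` at `sω`, these weights are the `∂_p^{n-2}` of the Radon
transforms of `div f` and of `(n-1) ⟨f, v⟩ - div (⟨x, v⟩ f) = (n-2) ⟨f, v⟩ - ⟨x, v⟩ div f`
(`radonInversion_scalarWeight`, `radonInversion_vectorWeight`). Fourier inversion in polar
coordinates (`radonInversion_eq`) recovers both functions, and their combination is
`(n-2) ⟨f, v⟩`. Uniqueness follows, since the reconstruction uses the data only.

The points `γ₁`, `γ₂` are different for almost every hyperplane that meets `B`, because
a nonempty open subset of a hyperplane has positive volume (`IndependentOnSlice.ne`); for the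
same reason the hypotheses force `n ≥ 3` (`IndependentOnSlice.three_le`).
-/

/-! ### The frame attached to spherical coordinates -/

/-- The coordinate vector of the `r`-th coordinate counted from the bottom. -/
noncomputable def bottomVector {n : ℕ} (r : ℕ) (hr : r < n) : Rn n :=
  EuclideanSpace.single ⟨n - 1 - r, by omega⟩ 1

/-- The point with the angles `φ_{m+1}, φ_{m+2}, …` of the unit sphere in the span of the
coordinates `r ≥ m` (counted from the bottom). For `m = 0` it is `sphericalPoint φ`. -/
noncomputable def tailVector {n : ℕ} (φ : Fin (n - 1) → ℝ) (m : ℕ) : Rn n :=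
  WithLp.toLp 2 fun k : Fin n =>
    if n - 1 - k.val < m then 0
    else (∏ j : Fin (n - 1), if m ≤ j.val ∧ j.val < n - 1 - k.val then Real.sin (φ j) else 1) *
      cosFactor φ (n - 1 - k.val)

lemma sphericalPoint_eq_tailVector {n : ℕ} (φ : Fin (n - 1) → ℝ) :
    sphericalPoint φ = tailVector φ 0 := by
  ext k
  simp [sphericalPoint, tailVector]

lemma bottomVector_apply {n : ℕ} (r : ℕ) (hr : r < n) (k : Fin n) :
    bottomVector r hr k = if n - 1 - k.val = r then 1 else 0 := by
  have := k.2
  simp only [bottomVector, PiLp.single_apply, Fin.ext_iff]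
  congr 1
  apply propext
  omega

lemma tailVector_eq {n : ℕ} (φ : Fin (n - 1) → ℝ) (i : Fin (n - 1)) :
    tailVector φ i = Real.cos (φ i) • bottomVector i.val (by omega) +
      Real.sin (φ i) • tailVector φ (i.val + 1) := by
  ext k
  simp only [PiLp.add_apply, PiLp.smul_apply, bottomVector_apply, tailVector, smul_eq_mul]
  rcases lt_trichotomy (n - 1 - k.val) i.val with h | h | h
  · simp [h, h.ne, show n - 1 - k.val < i.val + 1 by omega]
  · have hc : cosFactor φ (n - 1 - k.val) = Real.cos (φ i) := by
      rw [h, cosFactor, dif_pos i.2]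
    rw [hc, if_neg (by omega), if_pos h, if_pos (by omega), Finset.prod_eq_one]
    · ring
    · intro j _
      rw [if_neg (by omega)]
  · have hp : (∏ j : Fin (n - 1), if i.val ≤ j.val ∧ j.val < n - 1 - k.val
          then Real.sin (φ j) else 1) = Real.sin (φ i) *
        ∏ j : Fin (n - 1), if i.val + 1 ≤ j.val ∧ j.val < n - 1 - k.val
          then Real.sin (φ j) else 1 := by
      have h1 : Real.sin (φ i) = ∏ j : Fin (n - 1), if j = i then Real.sin (φ j) else 1 := by
        simp
      rw [h1, ← Finset.prod_mul_distrib]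
      refine Finset.prod_congr rfl fun j _ => ?_
      rcases lt_trichotomy i.val j.val with hj | hj | hj
      · simp [show j ≠ i by rintro rfl; omega, hj.le, Nat.succ_le_of_lt hj]
      · obtain rfl := Fin.ext hj
        simp [h]
      · simp [show j ≠ i by rintro rfl; omega, show ¬ i.val ≤ j.val by omega,
          show ¬ i.val + 1 ≤ j.val by omega]
    rw [if_neg (by omega), if_neg (by omega), if_neg (by omega), hp]
    ring

lemma frameVector_eq {n : ℕ} (φ : Fin (n - 1) → ℝ) (i : Fin (n - 1)) :
    frameVector φ i = -Real.sin (φ i) • bottomVector i.val (by omega) +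
      Real.cos (φ i) • tailVector φ (i.val + 1) := by
  ext k
  simp only [PiLp.add_apply, PiLp.smul_apply, bottomVector_apply, tailVector, smul_eq_mul,
    frameVector]
  rcases lt_trichotomy (n - 1 - k.val) i.val with h | h | h
  · simp [h, h.ne, show n - 1 - k.val < i.val + 1 by omega]
  · simp [h]
  · rw [if_neg (by omega), if_neg (by omega), if_neg (by omega), if_neg (by omega)]
    simp only [Nat.succ_le_iff]
    ring

lemma inner_bottomVector {n : ℕ} (r : ℕ) (hr : r < n) (x : Rn n) :
    ⟪bottomVector r hr, x⟫ = x ⟨n - 1 - r, by omega⟩ := by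
  simp [bottomVector, EuclideanSpace.inner_single_left]

lemma inner_bottomVector_self {n : ℕ} (r : ℕ) (hr : r < n) :
    ⟪bottomVector r hr, bottomVector r hr⟫ = 1 := by
  simp [bottomVector]

lemma inner_bottomVector_tailVector {n : ℕ} (φ : Fin (n - 1) → ℝ) {r m : ℕ} (hr : r < n)
    (h : r < m) : ⟪bottomVector r hr, tailVector φ m⟫ = 0 := by
  rw [inner_bottomVector]
  simp [tailVector, show n - 1 - (n - 1 - r) < m by omega]

lemma inner_bottomVector_frameVector {n : ℕ} (φ : Fin (n - 1) → ℝ) {r : ℕ} (hr : r < n)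
    (i : Fin (n - 1)) (h : r < i) : ⟪bottomVector r hr, frameVector φ i⟫ = 0 := by
  rw [inner_bottomVector]
  simp [frameVector, show n - 1 - (n - 1 - r) < i.val by omega]

lemma inner_tailVector_self {n : ℕ} (φ : Fin (n - 1) → ℝ) {m : ℕ} (hm : m < n) :
    ⟪tailVector φ m, tailVector φ m⟫ = 1 := by
  obtain ⟨d, hd⟩ : ∃ d, m + d + 1 = n := ⟨n - 1 - m, by omega⟩
  induction d generalizing m with
  | zero =>
    have : tailVector φ m = bottomVector m hm := by
      ext k
      have := k.2
      simp only [tailVector, bottomVector_apply]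
      by_cases h : n - 1 - k.val = m
      · rw [if_neg (by omega), if_pos h, h, cosFactor, dif_neg (by omega), Finset.prod_eq_one]
        · simp
        · intro j _
          rw [if_neg (by omega)]
      · rw [if_pos (by omega), if_neg h]
    rw [this, inner_bottomVector_self]
  | succ d ih =>
    have h1 := ih (m := m + 1) (by omega) (by omega)
    have h2 := tailVector_eq φ ⟨m, by omega⟩
    have h3 := inner_bottomVector_tailVector φ hm (Nat.lt_succ_self m)
    have h4 := inner_bottomVector_self m hm
    rw [h2]
    simp only [inner_add_left, inner_add_right, real_inner_smul_left, real_inner_smul_right]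
    rw [real_inner_comm (bottomVector m hm) (tailVector φ (m + 1)), h1, h3, h4]
    nlinarith [Real.sin_sq_add_cos_sq (φ ⟨m, by omega⟩)]

lemma inner_tailVector_frameVector {n : ℕ} (φ : Fin (n - 1) → ℝ) (i : Fin (n - 1)) {m : ℕ}
    (hm : m ≤ i) : ⟪tailVector φ m, frameVector φ i⟫ = 0 := by
  obtain ⟨d, hd⟩ : ∃ d, m + d = i.val := ⟨i.val - m, by omega⟩
  induction d generalizing m with
  | zero =>
    obtain rfl : m = i.val := by omega
    have h1 := inner_tailVector_self φ (m := i.val + 1) (by omega)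
    have h3 := inner_bottomVector_tailVector φ (r := i.val) (by omega) (Nat.lt_succ_self i.val)
    have h4 := inner_bottomVector_self (n := n) i.val (by omega)
    rw [tailVector_eq, frameVector_eq]
    simp only [inner_add_left, inner_add_right, real_inner_smul_left, real_inner_smul_right]
    rw [real_inner_comm (bottomVector i.val _) (tailVector φ (i.val + 1)), h1, h3, h4]
    ring
  | succ d ih =>
    have h1 := ih (m := m + 1) (by omega) (by omega)
    have h2 := tailVector_eq φ ⟨m, by omega⟩
    simp only at h2
    rw [h2, inner_add_left, real_inner_smul_left, real_inner_smul_left, h1,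
      inner_bottomVector_frameVector φ _ i (by omega)]
    ring

lemma inner_frameVector_of_lt {n : ℕ} (φ : Fin (n - 1) → ℝ) {i j : Fin (n - 1)} (h : i < j) :
    ⟪frameVector φ i, frameVector φ j⟫ = 0 := by
  rw [frameVector_eq φ i, inner_add_left, real_inner_smul_left, real_inner_smul_left,
    inner_bottomVector_frameVector φ _ j h, inner_tailVector_frameVector φ j h]
  ring

lemma inner_frameVector_self {n : ℕ} (φ : Fin (n - 1) → ℝ) (i : Fin (n - 1)) :
    ⟪frameVector φ i, frameVector φ i⟫ = 1 := by
  have h1 := inner_tailVector_self φ (m := i.val + 1) (by omega)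
  have h3 := inner_bottomVector_tailVector φ (r := i.val) (by omega) (Nat.lt_succ_self i.val)
  have h4 := inner_bottomVector_self (n := n) i.val (by omega)
  rw [frameVector_eq]
  simp only [inner_add_left, inner_add_right, real_inner_smul_left, real_inner_smul_right]
  rw [real_inner_comm (bottomVector i.val _) (tailVector φ (i.val + 1)), h1, h3, h4]
  nlinarith [Real.sin_sq_add_cos_sq (φ i)]

lemma inner_frameVector {n : ℕ} (φ : Fin (n - 1) → ℝ) (i j : Fin (n - 1)) :
    ⟪frameVector φ i, frameVector φ j⟫ = if i = j then 1 else 0 := by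
  rcases lt_trichotomy i j with h | rfl | h
  · rw [inner_frameVector_of_lt φ h, if_neg h.ne]
  · rw [inner_frameVector_self, if_pos rfl]
  · rw [real_inner_comm, inner_frameVector_of_lt φ h, if_neg h.ne']

/-- The frame vectors form an orthonormal basis of the orthogonal complement of `ξ`. This holds for
every choice of the angles, also at the poles of the coordinates. -/
lemma sum_inner_frameVector_smul {n : ℕ} {ξ : Sn n} {φ : Fin (n - 1) → ℝ}
    (hφ : IsSphericalCoordinates ξ φ) (w : Rn n) :
    ∑ i, ⟪w, frameVector φ i⟫ • frameVector φ i = w - ⟪w, (ξ : Rn n)⟫ • (ξ : Rn n) := by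
  have hn : 0 < n := by
    by_contra h
    obtain rfl : n = 0 := by omega
    have := norm_eq_of_mem_sphere ξ
    rw [Subsingleton.elim (ξ : Rn 0) 0] at this
    simp at this
  have hξ : (ξ : Rn n) = tailVector φ 0 := by rw [← hφ.2.2, sphericalPoint_eq_tailVector]
  let b : Option (Fin (n - 1)) → Rn n := fun o => o.elim (ξ : Rn n) (frameVector φ)
  have hb : Orthonormal ℝ b := by
    rw [orthonormal_iff_ite]
    rintro (_ | i) (_ | j)
    · simp [b]
    · simpa [b, hξ] using inner_tailVector_frameVector φ j (Nat.zero_le _)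
    · simpa [b, hξ, real_inner_comm] using inner_tailVector_frameVector φ i (Nat.zero_le _)
    · simpa [b] using inner_frameVector φ i j
  have hcard : Fintype.card (Option (Fin (n - 1))) = Module.finrank ℝ (Rn n) := by
    simp; omega
  let B := (basisOfOrthonormalOfCardEqFinrank hb hcard).toOrthonormalBasis (by simpa using hb)
  have h := B.sum_repr' w
  rw [Fintype.sum_option] at h
  have h0 : B none = (ξ : Rn n) := by simp [B, b]
  have h1 : ∀ i, B (some i) = frameVector φ i := by simp [B, b]
  simp only [h0, h1] at h
  rw [eq_sub_iff_add_eq, add_comm]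
  simpa only [real_inner_comm w] using h

lemma inner_frameVector_point {n : ℕ} {ξ : Sn n} {φ : Fin (n - 1) → ℝ}
    (hφ : IsSphericalCoordinates ξ φ) (i : Fin (n - 1)) : ⟪(ξ : Rn n), frameVector φ i⟫ = 0 := by
  rw [← hφ.2.2, sphericalPoint_eq_tailVector, inner_tailVector_frameVector φ i (Nat.zero_le _)]

lemma linearIndependent_frameVector {n : ℕ} (φ : Fin (n - 1) → ℝ) :
    LinearIndependent ℝ (frameVector φ) :=
  ((orthonormal_iff_ite (𝕜 := ℝ)).2 (inner_frameVector φ)).linearIndependent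

/-! ### Cramer's rule for the mixed frame -/

/-- If `ξ₁`, `ξ₂` are independent, some frame vector at `ξ₂` is not orthogonal to `ξ₁`. -/
lemma exists_linearIndependent_mixedFrame {n : ℕ} (hn : 2 ≤ n) {ang : Sn n → Fin (n - 1) → ℝ}
    (h_ang : ∀ ξ : Sn n, IsSphericalCoordinates ξ (ang ξ)) {ξ₁ ξ₂ : Sn n}
    (h : LinearIndependent ℝ ![(ξ₁ : Rn n), (ξ₂ : Rn n)]) :
    ∃ l : Fin (n - 1), LinearIndependent ℝ (mixedFrame ang ξ₁ ξ₂ l) := by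
  obtain ⟨l, hl⟩ : ∃ l, ⟪(ξ₁ : Rn n), frameVector (ang ξ₂) l⟫ ≠ 0 := by
    by_contra! hcon
    have h1 := sum_inner_frameVector_smul (h_ang ξ₂) (ξ₁ : Rn n)
    simp only [hcon, zero_smul, Finset.sum_const_zero] at h1
    have h2 := LinearIndependent.pair_iff.1 h 1 (-⟪(ξ₁ : Rn n), (ξ₂ : Rn n)⟫)
      (by rw [one_smul, neg_smul, ← sub_eq_add_neg, ← h1])
    simp at h2
  refine ⟨l, ?_⟩
  obtain ⟨m, rfl⟩ : ∃ m, n = m + 1 := ⟨n - 1, by omega⟩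
  have hs : mixedFrame ang ξ₁ ξ₂ l =
      Fin.snoc (α := fun _ => Rn (m + 1)) (frameVector (ang ξ₁)) (frameVector (ang ξ₂) l) := by
    ext j : 1
    refine Fin.lastCases ?_ (fun j => ?_) j
    · simp [mixedFrame]
    · simp only [mixedFrame, Fin.snoc_castSucc]
      rw [dif_pos (by simp)]
      rfl
  rw [hs]
  refine (linearIndependent_frameVector (ang ξ₁)).finSnoc ?_
  intro hmem
  apply hl
  refine Submodule.span_induction (p := fun x _ => ⟪(ξ₁ : Rn (m + 1)), x⟫ = 0) ?_ ?_ ?_ ?_ hmem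
  · rintro _ ⟨i, rfl⟩
    exact inner_frameVector_point (h_ang ξ₁) i
  · simp
  · intro x y _ _ hx hy
    rw [inner_add_right, hx, hy, add_zero]
  · intro c x _ hx
    rw [real_inner_smul_right, hx, mul_zero]

lemma sum_cramerCoefficient_smul {n : ℕ} {w : Fin n → Rn n} (hw : LinearIndependent ℝ w)
    (v : Rn n) : ∑ j, cramerCoefficient w v j • w j = v := by
  have hdet : (columnMatrix w).det ≠ 0 := by
    have h1 : LinearIndependent ℝ (columnMatrix w).col :=
      hw.map' (WithLp.linearEquiv 2 ℝ (Fin n → ℝ)).toLinearMap (LinearEquiv.ker _)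
    exact ((Matrix.isUnit_iff_isUnit_det _).1
      (Matrix.linearIndependent_cols_iff_isUnit.1 h1)).ne_zero
  have h := Matrix.mulVec_cramer (columnMatrix w) (fun i => v i)
  ext i
  have hi := congrFun h i
  simp only [Matrix.mulVec, dotProduct, Matrix.cramer_apply, Pi.smul_apply, smul_eq_mul] at hi
  simp only [cramerCoefficient, WithLp.ofLp_sum, Finset.sum_apply, PiLp.smul_apply, smul_eq_mul]
  rw [← mul_right_inj' hdet, ← hi, Finset.mul_sum]
  refine Finset.sum_congr rfl fun j _ => ?_
  rw [columnMatrix, Matrix.of_apply, ← columnMatrix]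
  field_simp

/-! ### Polar coordinates and integration over parallel hyperplanes -/

section Polar

variable {E F : Type*} [NormedAddCommGroup E] [NormedSpace ℝ E] [MeasurableSpace E] [BorelSpace E]
  [FiniteDimensional ℝ E] [NormedAddCommGroup F] [NormedSpace ℝ F]

lemma integral_volumeIoiPow (k : ℕ) (g : ℝ → F) :
    ∫ r : Ioi (0 : ℝ), g r ∂(Measure.volumeIoiPow k) = ∫ r in Ioi (0 : ℝ), r ^ k • g r := by
  simp only [Measure.volumeIoiPow, ENNReal.ofReal]
  rw [integral_withDensity_eq_integral_smul,
    integral_subtype_comap measurableSet_Ioi fun a ↦ Real.toNNReal (a ^ k) • g a,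
    setIntegral_congr_fun measurableSet_Ioi fun x hx ↦ ?_]
  · rw [NNReal.smul_def, Real.coe_toNNReal _ (pow_nonneg hx.out.le _)]
  · exact (measurable_subtype_coe.pow_const _).real_toNNReal

/-- Integration in polar coordinates. -/
lemma integral_eq_integral_sphere [Nontrivial E] (μ : Measure E) [μ.IsAddHaarMeasure] {g : E → F}
    (hg : Integrable g μ) :
    ∫ x, g x ∂μ = ∫ θ : Metric.sphere (0 : E) 1,
      (∫ t in Ioi (0 : ℝ), t ^ (Module.finrank ℝ E - 1) • g (t • (θ : E))) ∂μ.toSphere := by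
  have hmp := μ.measurePreserving_homeomorphUnitSphereProd
  have hemb := (homeomorphUnitSphereProd E).measurableEmbedding
  let G : Metric.sphere (0 : E) 1 × Ioi (0 : ℝ) → F := fun z => g ((z.2 : ℝ) • (z.1 : E))
  have hG : ∀ x : ({0}ᶜ : Set E), G (homeomorphUnitSphereProd E x) = g x := by
    intro x
    have h := congrArg Subtype.val ((homeomorphUnitSphereProd E).symm_apply_apply x)
    rw [homeomorphUnitSphereProd_symm_apply_coe] at h
    simp only [G, h]
  have hGi : Integrable G (μ.toSphere.prod (.volumeIoiPow (Module.finrank ℝ E - 1))) := by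
    rw [← hmp.integrable_comp_emb hemb]
    have : (G ∘ homeomorphUnitSphereProd E) = fun x : ({0}ᶜ : Set E) => g x := funext hG
    rw [this]
    exact (integrableOn_iff_comap_subtypeVal (measurableSet_singleton _).compl).1 hg.integrableOn
  calc ∫ x, g x ∂μ = ∫ x : ({0}ᶜ : Set E), g x ∂(μ.comap (↑)) := by
        rw [integral_subtype_comap (measurableSet_singleton _).compl fun x ↦ g x,
          restrict_compl_singleton]
    _ = ∫ x : ({0}ᶜ : Set E), G (homeomorphUnitSphereProd E x) ∂(μ.comap (↑)) := by
        simp only [hG]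
    _ = ∫ z, G z ∂(μ.toSphere.prod (.volumeIoiPow (Module.finrank ℝ E - 1))) :=
        hmp.integral_comp hemb G
    _ = _ := by
        rw [integral_prod _ hGi]
        refine integral_congr_ae (Filter.Eventually.of_forall fun θ => ?_)
        exact integral_volumeIoiPow _ fun t => g (t • (θ : E))

end Polar

section Slice

variable {V F : Type*} [NormedAddCommGroup V] [InnerProductSpace ℝ V] [MeasurableSpace V]
  [BorelSpace V] [FiniteDimensional ℝ V] [NormedAddCommGroup F] [NormedSpace ℝ F]

/-- The integral of `u` over the hyperplane `⟨ω, x⟩ = p`, that is, its Radon transform. -/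
noncomputable def slice (ω : V) (u : V → F) (p : ℝ) : F :=
  ∫ y : (ℝ ∙ ω)ᗮ, u (p • ω + (y : V))

/-- The orthogonal decomposition `(p, y) ↦ p ω + y` preserves the volume. -/
lemma measurePreserving_smul_add {ω : V} (hω : ‖ω‖ = 1) :
    MeasurePreserving (fun z : ℝ × (ℝ ∙ ω)ᗮ => z.1 • ω + (z.2 : V))
      ((volume : Measure ℝ).prod volume) volume := by
  have h1 := (LinearIsometryEquiv.toSpanUnitSingleton (𝕜 := ℝ) ω hω).measurePreserving
  have h2 := h1.prod (MeasurePreserving.id (volume : Measure (ℝ ∙ ω)ᗮ))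
  have h3 := WithLp.volume_preserving_toLp (ℝ ∙ ω) (ℝ ∙ ω)ᗮ
  have h4 := (ℝ ∙ ω).orthogonalDecomposition.symm.measurePreserving
  have h5 : (fun z : ℝ × (ℝ ∙ ω)ᗮ => z.1 • ω + (z.2 : V)) =
      ((ℝ ∙ ω).orthogonalDecomposition.symm ∘ WithLp.toLp 2) ∘
        Prod.map (LinearIsometryEquiv.toSpanUnitSingleton ω hω) id := by
    ext z
    simp
  rw [h5]
  exact (h4.comp h3).comp h2

lemma measurableEmbedding_smul_add {ω : V} (hω : ‖ω‖ = 1) :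
    MeasurableEmbedding (fun z : ℝ × (ℝ ∙ ω)ᗮ => z.1 • ω + (z.2 : V)) := by
  refine Continuous.measurableEmbedding (by fun_prop) ?_
  rintro ⟨p, y⟩ ⟨p', y'⟩ h
  have hy : ∀ y : (ℝ ∙ ω)ᗮ, ⟪ω, (y : V)⟫ = 0 := fun y =>
    Submodule.mem_orthogonal_singleton_iff_inner_right.1 y.2
  have hp : p = p' := by
    have := congrArg (fun x => ⟪ω, x⟫) h
    simpa [inner_add_right, real_inner_smul_right, hy, hω] using this
  subst hp
  simpa using h

lemma integral_eq_integral_slice {ω : V} (hω : ‖ω‖ = 1) {g : V → F} (hg : Integrable g) :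
    ∫ x, g x = ∫ p : ℝ, slice ω g p := by
  have hmp := measurePreserving_smul_add hω
  have hemb := measurableEmbedding_smul_add hω
  rw [← hmp.integral_comp hemb, integral_prod]
  · rfl
  · exact (hmp.integrable_comp_emb hemb).2 hg

end Slice

/-! ### Test functions and directional derivatives -/

section TestFunctions

variable {V F G : Type*} [NormedAddCommGroup V] [InnerProductSpace ℝ V]
  [NormedAddCommGroup F] [NormedSpace ℝ F] [NormedAddCommGroup G] [NormedSpace ℝ G]

/-- `u` is smooth with compact support. -/
structure IsTestFunction (u : V → F) : Prop where
  contDiff : ContDiff ℝ (⊤ : ℕ∞) u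
  hasCompactSupport : HasCompactSupport u

/-- The directional derivative `∂_m u`. -/
noncomputable def dirDeriv (m : V) (u : V → F) : V → F := fun x => fderiv ℝ u x m

lemma tsupport_dirDeriv_subset (m : V) (u : V → F) : tsupport (dirDeriv m u) ⊆ tsupport u :=
  tsupport_fderiv_apply_subset ℝ m

lemma tsupport_iterate_dirDeriv_subset (m : V) (u : V → F) (k : ℕ) :
    tsupport ((dirDeriv m)^[k] u) ⊆ tsupport u := by
  induction k with
  | zero => simp
  | succ k ih =>
    rw [Function.iterate_succ_apply']
    exact (tsupport_dirDeriv_subset m _).trans ih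

namespace IsTestFunction

variable {u w : V → F}

lemma continuous (hu : IsTestFunction u) : Continuous u := hu.contDiff.continuous

lemma differentiable (hu : IsTestFunction u) : Differentiable ℝ u :=
  hu.contDiff.differentiable (by simp)

lemma integrable [MeasurableSpace V] [BorelSpace V] [FiniteDimensional ℝ V]
    (hu : IsTestFunction u) : Integrable u :=
  hu.continuous.integrable_of_hasCompactSupport hu.hasCompactSupport

lemma dirDeriv (hu : IsTestFunction u) (m : V) : IsTestFunction (dirDeriv m u) where
  contDiff := (hu.contDiff.fderiv_right (by simp)).clm_apply contDiff_const
  hasCompactSupport := hu.hasCompactSupport.fderiv_apply ℝ m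

lemma iterate_dirDeriv (hu : IsTestFunction u) (m : V) (k : ℕ) :
    IsTestFunction ((_root_.dirDeriv m)^[k] u) := by
  induction k with
  | zero => exact hu
  | succ k ih =>
    rw [Function.iterate_succ_apply']
    exact ih.dirDeriv m

lemma add (hu : IsTestFunction u) (hw : IsTestFunction w) : IsTestFunction fun x => u x + w x where
  contDiff := hu.contDiff.add hw.contDiff
  hasCompactSupport := hu.hasCompactSupport.add hw.hasCompactSupport

lemma sub (hu : IsTestFunction u) (hw : IsTestFunction w) : IsTestFunction fun x => u x - w x where
  contDiff := hu.contDiff.sub hw.contDiff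
  hasCompactSupport := hu.hasCompactSupport.sub hw.hasCompactSupport

lemma clm (hu : IsTestFunction u) (L : F →L[ℝ] G) : IsTestFunction fun x => L (u x) where
  contDiff := L.contDiff.comp hu.contDiff
  hasCompactSupport := hu.hasCompactSupport.comp_left (g := L) (map_zero L)

lemma ofReal {u : V → ℝ} (hu : IsTestFunction u) : IsTestFunction fun x => (u x : ℂ) :=
  hu.clm Complex.ofRealCLM

lemma smul (hu : IsTestFunction u) {c : V → ℝ} (hc : ContDiff ℝ (⊤ : ℕ∞) c) :
    IsTestFunction fun x => c x • u x where
  contDiff := hc.smul hu.contDiff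
  hasCompactSupport := hu.hasCompactSupport.smul_left

lemma smul_right {u : V → ℝ} (hu : IsTestFunction u) {c : V → F} (hc : ContDiff ℝ (⊤ : ℕ∞) c) :
    IsTestFunction fun x => u x • c x where
  contDiff := hu.contDiff.smul hc
  hasCompactSupport := hu.hasCompactSupport.smul_right

lemma sum {ι : Type*} {s : Finset ι} {u : ι → V → F} (hu : ∀ i ∈ s, IsTestFunction (u i)) :
    IsTestFunction fun x => ∑ i ∈ s, u i x := by
  classical
  induction s using Finset.induction_on with
  | empty => simpa using (⟨contDiff_const, .zero⟩ : IsTestFunction fun _ : V => (0 : F))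
  | insert a s ha ih =>
    simp only [Finset.sum_insert ha]
    exact (hu a (by simp)).add (ih fun i hi => hu i (by simp [hi]))

lemma dirDeriv_clm (hu : IsTestFunction u) (L : F →L[ℝ] G) (m : V) :
    _root_.dirDeriv m (fun x => L (u x)) = fun x => L (_root_.dirDeriv m u x) := by
  ext x
  have h : HasFDerivAt (fun x => L (u x)) (L ∘L fderiv ℝ u x) x :=
    L.hasFDerivAt.comp x (hu.differentiable x).hasFDerivAt
  simp [_root_.dirDeriv, h.fderiv]

lemma iterate_dirDeriv_clm (hu : IsTestFunction u) (L : F →L[ℝ] G) (m : V) (k : ℕ) :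
    (_root_.dirDeriv m)^[k] (fun x => L (u x)) = fun x => L ((_root_.dirDeriv m)^[k] u x) := by
  induction k with
  | zero => rfl
  | succ k ih =>
    rw [Function.iterate_succ_apply', ih, (hu.iterate_dirDeriv m k).dirDeriv_clm L m,
      Function.iterate_succ_apply']

lemma dirDeriv_add (hu : IsTestFunction u) (hw : IsTestFunction w) (m : V) :
    _root_.dirDeriv m (fun x => u x + w x) =
      fun x => _root_.dirDeriv m u x + _root_.dirDeriv m w x := by
  ext x
  simp [_root_.dirDeriv, fderiv_fun_add (hu.differentiable x) (hw.differentiable x)]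

lemma iterate_dirDeriv_add (hu : IsTestFunction u) (hw : IsTestFunction w) (m : V) (k : ℕ) :
    (_root_.dirDeriv m)^[k] (fun x => u x + w x) =
      fun x => (_root_.dirDeriv m)^[k] u x + (_root_.dirDeriv m)^[k] w x := by
  induction k with
  | zero => rfl
  | succ k ih =>
    simp only [Function.iterate_succ_apply']
    rw [ih, (hu.iterate_dirDeriv m k).dirDeriv_add (hw.iterate_dirDeriv m k) m]

lemma iterate_dirDeriv_sub (hu : IsTestFunction u) (hw : IsTestFunction w) (m : V) (k : ℕ) :
    (_root_.dirDeriv m)^[k] (fun x => u x - w x) =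
      fun x => (_root_.dirDeriv m)^[k] u x - (_root_.dirDeriv m)^[k] w x := by
  have hw' : IsTestFunction fun x => (-1 : ℝ) • w x := hw.smul contDiff_const
  have h1 := hu.iterate_dirDeriv_add hw' m k
  have h2 := hw.iterate_dirDeriv_clm ((-1 : ℝ) • ContinuousLinearMap.id ℝ F) m k
  simp only [_root_.smul_apply, ContinuousLinearMap.id_apply] at h2
  rw [h2] at h1
  simpa only [neg_smul, one_smul, ← sub_eq_add_neg] using h1

/-- Leibniz rule for the product with the affine function `⟨m, x⟩ - p`. -/
lemma iterate_dirDeriv_affine_smul (hu : IsTestFunction u) {m : V} (hm : ‖m‖ = 1) (p : ℝ) (k : ℕ) :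
    (_root_.dirDeriv m)^[k + 1] (fun x => (⟪m, x⟫ - p) • u x) =
      fun x => (⟪m, x⟫ - p) • (_root_.dirDeriv m)^[k + 1] u x +
        ((k : ℝ) + 1) • (_root_.dirDeriv m)^[k] u x := by
  have key : ∀ {v : V → F}, IsTestFunction v →
      _root_.dirDeriv m (fun x => (⟪m, x⟫ - p) • v x) =
        fun x => (⟪m, x⟫ - p) • _root_.dirDeriv m v x + v x := by
    intro v hv
    ext x
    have h1 : HasFDerivAt (fun x : V => ⟪m, x⟫ - p) (innerSL ℝ m) x :=
      (innerSL ℝ m).hasFDerivAt.sub_const p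
    have h2 := (h1.smul (hv.differentiable x).hasFDerivAt).fderiv
    change fderiv ℝ (fun x => (⟪m, x⟫ - p) • v x) x = _ at h2
    simp [_root_.dirDeriv, h2, hm]
  have hc : ContDiff ℝ (⊤ : ℕ∞) fun x : V => ⟪m, x⟫ - p :=
    ((innerSL ℝ m).contDiff).sub contDiff_const
  induction k with
  | zero => simpa using key hu
  | succ k ih =>
    have h1 := hu.iterate_dirDeriv m (k + 1)
    have h2 : IsTestFunction fun x => ((k : ℝ) + 1) • (_root_.dirDeriv m)^[k] u x :=
      (hu.iterate_dirDeriv m k).smul contDiff_const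
    have h3 := (hu.iterate_dirDeriv m k).dirDeriv_clm
      (((k : ℝ) + 1) • ContinuousLinearMap.id ℝ F) m
    simp only [_root_.smul_apply, ContinuousLinearMap.id_apply] at h3
    rw [Function.iterate_succ_apply', ih, dirDeriv_add (h1.smul hc) h2, key h1, h3]
    ext x
    simp only [Function.iterate_succ_apply', Nat.cast_add, Nat.cast_one]
    module

end IsTestFunction

end TestFunctions

/-! ### Fourier transform and Radon inversion -/

section Fourier

open FourierTransform

variable {V : Type*} [NormedAddCommGroup V] [InnerProductSpace ℝ V] [MeasurableSpace V]
  [BorelSpace V] [FiniteDimensional ℝ V]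

/-- The Fourier transform of a real-valued function. -/
noncomputable def realFourier (u : V → ℝ) (w : V) : ℂ :=
  ∫ x, Complex.exp (-(2 * Real.pi * Complex.I * (⟪w, x⟫ : ℝ))) * (u x : ℂ)

lemma realFourier_eq_fourier (u : V → ℝ) (w : V) :
    realFourier u w = 𝓕 (fun x => (u x : ℂ)) w := by
  rw [realFourier, Real.fourier_eq']
  refine integral_congr_ae (Filter.Eventually.of_forall fun x => ?_)
  simp only [smul_eq_mul, real_inner_comm w x]
  congr 2
  push_cast
  ring

namespace IsTestFunction

variable {u v : V → ℝ}

lemma realFourier_dirDeriv (hu : IsTestFunction u) (m w : V) :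
    realFourier (_root_.dirDeriv m u) w =
      2 * Real.pi * Complex.I * (⟪m, w⟫ : ℝ) * realFourier u w := by
  have hd : (fun x => ((_root_.dirDeriv m u x : ℝ) : ℂ)) =
      fun x => fderiv ℝ (fun x => (u x : ℂ)) x m :=
    (hu.dirDeriv_clm Complex.ofRealCLM m).symm
  have hc := hu.ofReal
  have hint : Integrable (fderiv ℝ fun x => (u x : ℂ)) :=
    (hc.contDiff.continuous_fderiv (by simp)).integrable_of_hasCompactSupport
      (hc.hasCompactSupport.fderiv ℝ)
  have h := Real.fourier_fderiv hc.integrable hc.differentiable hint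
  rw [realFourier_eq_fourier, hd, ← Real.fourier_continuousLinearMap_apply hint, h]
  simp only [VectorFourier.fourierSMulRight_apply, realFourier_eq_fourier, neg_apply,
    smul_eq_mul, Complex.real_smul]
  have hwm : innerSL ℝ w m = ⟪m, w⟫ := real_inner_comm _ _
  -- The pairing comes from `fourierSMulRight`, and equals the one in `hwm` only after unfolding.
  erw [hwm]
  push_cast
  ring

lemma realFourier_iterate_dirDeriv (hu : IsTestFunction u) {ω : V} (hω : ‖ω‖ = 1) (s : ℝ) (k : ℕ) :
    realFourier ((_root_.dirDeriv ω)^[k] u) (s • ω) =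
      (2 * Real.pi * Complex.I * s) ^ k * realFourier u (s • ω) := by
  induction k with
  | zero => simp
  | succ k ih =>
    rw [Function.iterate_succ_apply', (hu.iterate_dirDeriv ω k).realFourier_dirDeriv, ih,
      real_inner_smul_right, real_inner_self_eq_norm_sq, hω]
    push_cast
    ring

lemma integrable_exp_mul (hu : IsTestFunction u) (w : V) :
    Integrable fun x =>
      Complex.exp (-(2 * Real.pi * Complex.I * (⟪w, x⟫ : ℝ))) * (u x : ℂ) := by
  have := hu.continuous
  exact Continuous.integrable_of_hasCompactSupport (by fun_prop)
    hu.ofReal.hasCompactSupport.mul_left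

lemma realFourier_sub (hu : IsTestFunction u) (hv : IsTestFunction v) (w : V) :
    realFourier (fun x => u x - v x) w = realFourier u w - realFourier v w := by
  rw [realFourier, realFourier, realFourier,
    ← integral_sub (hu.integrable_exp_mul w) (hv.integrable_exp_mul w)]
  simp only [Complex.ofReal_sub, mul_sub]

lemma realFourier_sum {ι : Type*} {s : Finset ι} {u : ι → V → ℝ}
    (hu : ∀ i ∈ s, IsTestFunction (u i)) (w : V) :
    realFourier (fun x => ∑ i ∈ s, u i x) w = ∑ i ∈ s, realFourier (u i) w := by
  simp only [realFourier]
  rw [← integral_finsetSum s fun i hi => (hu i hi).integrable_exp_mul w]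
  simp only [Complex.ofReal_sum, Finset.mul_sum]

lemma integrable_realFourier (hu : IsTestFunction u) : Integrable (realFourier u) := by
  have h := (𝓕 (hu.ofReal.hasCompactSupport.toSchwartzMap hu.ofReal.contDiff)).integrable
    (μ := volume)
  rw [SchwartzMap.fourier_coe] at h
  exact h.congr (Filter.Eventually.of_forall fun w => (realFourier_eq_fourier u w).symm)

/-- Fourier inversion. -/
lemma integral_exp_mul_realFourier (hu : IsTestFunction u) (x : V) :
    ∫ w, Complex.exp (2 * Real.pi * Complex.I * (⟪x, w⟫ : ℝ)) * realFourier u w = u x := by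
  have hF : 𝓕 (fun x => (u x : ℂ)) = realFourier u :=
    funext fun w => (realFourier_eq_fourier u w).symm
  have h := hu.ofReal.continuous.fourierInv_fourier_eq hu.ofReal.integrable
    (hF ▸ hu.integrable_realFourier)
  have h1 := congrFun h x
  rw [hF, Real.fourierInv_eq'] at h1
  rw [← h1]
  refine integral_congr_ae (Filter.Eventually.of_forall fun w => ?_)
  simp only [smul_eq_mul, real_inner_comm x w]
  congr 2
  push_cast
  ring

/-- The projection-slice theorem: the Fourier transform in `p` of the Radon transform. -/
lemma integral_exp_mul_slice (hu : IsTestFunction u) {ω : V} (hω : ‖ω‖ = 1) (s : ℝ) :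
    ∫ p : ℝ, Complex.exp (-(2 * Real.pi * Complex.I * s * p)) * ((slice ω u p : ℝ) : ℂ) =
      realFourier u (s • ω) := by
  rw [realFourier, integral_eq_integral_slice hω (hu.integrable_exp_mul _)]
  refine integral_congr_ae (Filter.Eventually.of_forall fun p => ?_)
  simp only [slice]
  rw [← integral_complex_ofReal, ← integral_const_mul]
  refine integral_congr_ae (Filter.Eventually.of_forall fun y => ?_)
  have hy : ⟪ω, (y : V)⟫ = 0 := Submodule.mem_orthogonal_singleton_iff_inner_right.1 y.2
  simp only [inner_add_right, real_inner_smul_left, real_inner_smul_right, hy,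
    real_inner_self_eq_norm_sq, hω]
  congr 2
  push_cast
  ring

end IsTestFunction

/-- The Radon inversion formula, for data known only through their Fourier transform in `p`. -/
lemma radonInversion_eq {n : ℕ} (hn : 0 < n) (k : ℕ) {G : Sn n → ℝ → ℝ} {h : Rn n → ℝ}
    (hh : IsTestFunction h)
    (hG : ∀ᵐ ω ∂((volume : Measure (Rn n)).toSphere), ∀ s : ℝ, 0 < s →
      ∫ p : ℝ, Complex.exp (-(2 * Real.pi * Complex.I * s * p)) * (G ω p : ℂ) =
        (2 * Real.pi * Complex.I * s) ^ k * realFourier h (s • (ω : Rn n))) (x : Rn n) :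
    radonInversion k G x = h x := by
  have : Nonempty (Fin n) := ⟨⟨0, hn⟩⟩
  have hint : Integrable fun w : Rn n =>
      Complex.exp (2 * Real.pi * Complex.I * (⟪x, w⟫ : ℝ)) * realFourier h w := by
    refine hh.integrable_realFourier.bdd_mul (c := 1) (by fun_prop) ?_
    refine Filter.Eventually.of_forall fun w => ?_
    have : (2 * Real.pi * Complex.I * (⟪x, w⟫ : ℝ) : ℂ) =
      ((2 * Real.pi * ⟪x, w⟫ : ℝ) : ℂ) * Complex.I := by push_cast; ring
    rw [this, Complex.norm_exp_ofReal_mul_I]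
  have h1 := integral_eq_integral_sphere volume hint
  rw [hh.integral_exp_mul_realFourier x] at h1
  rw [radonInversion, ← Complex.ofReal_re (h x), h1]
  congr 1
  refine integral_congr_ae ?_
  filter_upwards [hG] with ω hω
  refine setIntegral_congr_fun measurableSet_Ioi fun s hs => ?_
  -- The factor `(2πis)^k` of the data cancels, as `s` is not `0`.
  have hs' : (2 * Real.pi * Complex.I * s : ℂ) ^ k ≠ 0 := by
    have : s ≠ 0 := (mem_Ioi.1 hs).ne'
    simp [this, Real.pi_ne_zero]
  simp only
  rw [hω s hs, finrank_euclideanSpace_fin, Complex.real_smul, real_inner_smul_right]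
  push_cast
  rw [mul_assoc _ (_ ^ k)⁻¹, inv_mul_cancel_left₀ hs', mul_assoc, ← mul_assoc _ (s : ℂ)]

/-! ### The divergence -/

/-- The divergence of a vector field. -/
noncomputable def divergence {n : ℕ} (g : Rn n → Rn n) (x : Rn n) : ℝ :=
  ∑ i, dirDeriv (EuclideanSpace.single i 1) (fun y => g y i) x

namespace IsTestFunction

variable {n : ℕ} {g : Rn n → Rn n}

lemma coord (hg : IsTestFunction g) (i : Fin n) : IsTestFunction fun y => g y i :=
  hg.clm (EuclideanSpace.proj i : Rn n →L[ℝ] ℝ)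

lemma inner_left (hg : IsTestFunction g) (v : Rn n) : IsTestFunction fun y => ⟪v, g y⟫ :=
  hg.clm (innerSL ℝ v)

lemma divergence (hg : IsTestFunction g) : IsTestFunction (_root_.divergence g) :=
  .sum fun i _ => (hg.coord i).dirDeriv _

/-- The Radon transform of `div g` is the `p`-derivative of that of `⟨ω, g⟩`, in its Fourier
form. -/
lemma realFourier_divergence (hg : IsTestFunction g) (ω : Rn n) (s : ℝ) :
    realFourier (_root_.divergence g) (s • ω) =
      2 * Real.pi * Complex.I * s * realFourier (fun y => ⟪ω, g y⟫) (s • ω) := by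
  have h1 : (fun y => ⟪ω, g y⟫) = fun y => ∑ i, ω i * g y i := by
    ext y
    simp [PiLp.inner_apply, mul_comm]
  have h2 : ∀ i, IsTestFunction fun y => ω i * g y i := fun i => (hg.coord i).smul contDiff_const
  have h3 : ∀ i w, realFourier (fun y => ω i * g y i) w = ω i * realFourier (fun y => g y i) w := by
    intro i w
    rw [realFourier, realFourier, ← integral_const_mul]
    refine integral_congr_ae (Filter.Eventually.of_forall fun x => ?_)
    push_cast
    ring
  unfold _root_.divergence
  rw [realFourier_sum fun i _ => (hg.coord i).dirDeriv _, h1, realFourier_sum fun i _ => h2 i,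
    Finset.mul_sum]
  refine Finset.sum_congr rfl fun i _ => ?_
  rw [h3, (hg.coord i).realFourier_dirDeriv, EuclideanSpace.inner_single_left]
  simp
  ring

lemma divergence_inner_smul (hg : IsTestFunction g) (v x : Rn n) :
    _root_.divergence (fun y => ⟪v, y⟫ • g y) x = ⟪v, g x⟫ + ⟪v, x⟫ * _root_.divergence g x := by
  have h1 : ∀ i : Fin n, _root_.dirDeriv (EuclideanSpace.single i 1) (fun y => (⟪v, y⟫ • g y) i) x =
      v i * g x i + ⟪v, x⟫ * _root_.dirDeriv (EuclideanSpace.single i 1) (fun y => g y i) x := by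
    intro i
    have h2 : HasFDerivAt (fun y : Rn n => ⟪v, y⟫) (innerSL ℝ v) x := (innerSL ℝ v).hasFDerivAt
    have h3 := (h2.mul ((hg.coord i).differentiable x).hasFDerivAt).fderiv
    simp only [_root_.dirDeriv, PiLp.smul_apply, smul_eq_mul]
    change fderiv ℝ (fun y => ⟪v, y⟫ * g y i) x = _ at h3
    rw [h3]
    simp [EuclideanSpace.inner_single_right]
    ring
  unfold _root_.divergence
  simp only [h1, Finset.sum_add_distrib, Finset.mul_sum]
  congr 1
  simp [PiLp.inner_apply, mul_comm]

end IsTestFunction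

end Fourier

/-! ### Integrals over half-lines -/

section HalfLine

variable {V F : Type*} [NormedAddCommGroup V] [InnerProductSpace ℝ V]
  [NormedAddCommGroup F] [NormedSpace ℝ F]

namespace IsTestFunction

variable {u : V → F}

lemma exists_bound (hu : IsTestFunction u) : ∃ C, ∀ x, ‖u x‖ ≤ C :=
  hu.hasCompactSupport.exists_bound_of_continuous hu.continuous

lemma hasDerivAt_integral (hu : IsTestFunction u) {w : ℝ → ℝ} {α β : ℝ}
    (hw : ContinuousOn w (uIcc α β)) (a θ ω : V) (q : ℝ) :
    HasDerivAt (fun q => ∫ t in α..β, w t • u (a + t • (θ + q • ω)))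
      (∫ t in α..β, (w t * t) • _root_.dirDeriv ω u (a + t • (θ + q • ω))) q := by
  have hc := hu.continuous
  have hd := hu.dirDeriv ω
  have hdc := hd.continuous
  obtain ⟨C, hC⟩ := hd.exists_bound
  have h1 : ∀ q : ℝ, ContinuousOn (fun t => w t • u (a + t • (θ + q • ω))) (uIcc α β) :=
    fun q => hw.smul (by fun_prop)
  have h2 : ContinuousOn (fun t => (w t * t) • _root_.dirDeriv ω u (a + t • (θ + q • ω)))
      (uIcc α β) := (hw.mul continuousOn_id).smul (by fun_prop)
  refine (intervalIntegral.hasDerivAt_integral_of_dominated_loc_of_deriv_le (s := univ)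
    (F' := fun q t => (w t * t) • _root_.dirDeriv ω u (a + t • (θ + q • ω)))
    (bound := fun t => ‖w t * t‖ * C) Filter.univ_mem ?_ (h1 q).intervalIntegrable ?_ ?_ ?_ ?_).2
  · exact Filter.Eventually.of_forall fun q =>
      ((h1 q).mono uIoc_subset_uIcc).aestronglyMeasurable measurableSet_uIoc
  · exact (h2.mono uIoc_subset_uIcc).aestronglyMeasurable measurableSet_uIoc
  · refine Filter.Eventually.of_forall fun t _ q _ => ?_
    rw [norm_smul]
    exact mul_le_mul_of_nonneg_left (hC _) (norm_nonneg _)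
  · exact ((hw.mul continuousOn_id).norm.mul continuousOn_const).intervalIntegrable
  · refine Filter.Eventually.of_forall fun t _ q _ => ?_
    have h3 : HasDerivAt (fun q : ℝ => a + t • (θ + q • ω)) (t • ω) q := by
      simpa using ((((hasDerivAt_id q).smul_const ω).const_add θ).const_smul t).const_add a
    have h4 := ((hu.differentiable
      (a + t • (θ + q • ω))).hasFDerivAt.comp_hasDerivAt q h3).const_smul (w t)
    refine HasDerivAt.congr_deriv h4 ?_
    change w t • fderiv ℝ u _ (t • ω) = (w t * t) • fderiv ℝ u _ ω
    rw [map_smul, smul_smul]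

lemma iteratedDeriv_integral (hu : IsTestFunction u) {w : ℝ → ℝ} {α β : ℝ}
    (hw : ContinuousOn w (uIcc α β)) (a θ ω : V) (k : ℕ) :
    iteratedDeriv k (fun q : ℝ => ∫ t in α..β, w t • u (a + t • (θ + q • ω))) =
      fun q => ∫ t in α..β, (w t * t ^ k) • (_root_.dirDeriv ω)^[k] u (a + t • (θ + q • ω)) := by
  induction k with
  | zero => simp
  | succ k ih =>
    ext q
    rw [iteratedDeriv_succ, ih, ((hu.iterate_dirDeriv ω k).hasDerivAt_integral
      (w := fun t => w t * t ^ k) (hw.mul (continuous_pow k).continuousOn) a θ ω q).deriv,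
      Function.iterate_succ_apply']
    simp only [pow_succ, mul_assoc]

end IsTestFunction

/-- A ray from a point `a` outside a compact set `K` is in `K` only for parameters between two
positive bounds, which are uniform in directions `ξ` with `1 ≤ ‖ξ‖ ≤ 2`. -/
lemma exists_Icc_of_notMem {K : Set V} (hK : IsCompact K) {a : V} (ha : a ∉ K) :
    ∃ α β : ℝ, 0 < α ∧ α ≤ β ∧ ∀ (t : ℝ) (ξ : V), 0 < t → 1 ≤ ‖ξ‖ → ‖ξ‖ ≤ 2 →
      a + t • ξ ∈ K → t ∈ Ioc α β := by
  obtain ⟨ε, hε, hεK⟩ := Metric.isOpen_iff.1 hK.isClosed.isOpen_compl a ha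
  obtain ⟨R, hR⟩ := hK.isBounded.subset_closedBall a
  refine ⟨ε / 4, max (ε / 4) R, by positivity, le_max_left _ _, fun t ξ ht h1 h2 hmem => ?_⟩
  have hdist : dist (a + t • ξ) a = t * ‖ξ‖ := by
    rw [dist_eq_norm, add_sub_cancel_left, norm_smul, Real.norm_of_nonneg ht.le]
  constructor
  · by_contra! hlt
    refine hεK ?_ hmem
    rw [Metric.mem_ball, hdist]
    nlinarith
  · have := hR hmem
    rw [Metric.mem_closedBall, hdist] at this
    exact le_max_of_le_right (by nlinarith)

lemma setIntegral_Ioi_eq_intervalIntegral {w : ℝ → ℝ} {u : V → F} {a ξ : V} {α β : ℝ} (hα : 0 < α)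
    (hαβ : α ≤ β) (h : ∀ t : ℝ, 0 < t → a + t • ξ ∈ tsupport u → t ∈ Ioc α β) :
    ∫ t in Ioi (0 : ℝ), w t • u (a + t • ξ) = ∫ t in α..β, w t • u (a + t • ξ) := by
  rw [intervalIntegral.integral_of_le hαβ]
  refine setIntegral_eq_of_subset_of_forall_sdiff_eq_zero measurableSet_Ioi
    (fun t ht => hα.trans ht.1) fun t ht => ?_
  have : a + t • ξ ∉ tsupport u := fun hm => ht.2 (h t ht.1 hm)
  rw [image_eq_zero_of_notMem_tsupport this, smul_zero]

lemma norm_add_smul_mem_Icc {ω : V} (hω : ‖ω‖ = 1) (θ : Metric.sphere (0 : (ℝ ∙ ω)ᗮ) 1) {q : ℝ}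
    (hq : |q| < 1) : 1 ≤ ‖((θ : (ℝ ∙ ω)ᗮ) : V) + q • ω‖ ∧ ‖((θ : (ℝ ∙ ω)ᗮ) : V) + q • ω‖ ≤ 2 := by
  have hθ : ‖((θ : (ℝ ∙ ω)ᗮ) : V)‖ = 1 := norm_eq_of_mem_sphere θ
  have hθω : ⟪((θ : (ℝ ∙ ω)ᗮ) : V), q • ω⟫ = 0 := by
    rw [real_inner_smul_right, real_inner_comm,
      Submodule.mem_orthogonal_singleton_iff_inner_right.1 (θ : (ℝ ∙ ω)ᗮ).2, mul_zero]
  have h1 := norm_add_sq_eq_norm_sq_add_norm_sq_of_inner_eq_zero _ _ hθω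
  constructor
  · nlinarith [norm_nonneg (((θ : (ℝ ∙ ω)ᗮ) : V) + q • ω), sq_nonneg ‖q • ω‖]
  · refine (norm_add_le _ _).trans ?_
    rw [hθ, norm_smul, hω, Real.norm_eq_abs]
    linarith

end HalfLine

section Cone

variable {V F : Type*} [NormedAddCommGroup V] [InnerProductSpace ℝ V] [MeasurableSpace V]
  [BorelSpace V] [FiniteDimensional ℝ V] [NormedAddCommGroup F] [NormedSpace ℝ F]

lemma IsTestFunction.integrable_slice {u : V → F} (hu : IsTestFunction u) (ω x : V) :
    Integrable fun y : (ℝ ∙ ω)ᗮ => u (x + (y : V)) := by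
  have hc := hu.continuous
  refine Continuous.integrable_of_hasCompactSupport (by fun_prop) ?_
  refine hu.hasCompactSupport.comp_isClosedEmbedding (g := fun y : (ℝ ∙ ω)ᗮ => x + (y : V)) ?_
  exact (Homeomorph.addLeft x).isClosedEmbedding.comp
    (Submodule.closed_of_finiteDimensional _).isClosedEmbedding_subtypeVal

lemma integral_translate_eq_slice (ω : V) (hω : ‖ω‖ = 1) (u : V → F) (a : V) :
    ∫ y : (ℝ ∙ ω)ᗮ, u (a + (y : V)) = slice ω u ⟪ω, a⟫ := by
  have ha : a - ⟪ω, a⟫ • ω ∈ (ℝ ∙ ω)ᗮ := by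
    rw [Submodule.mem_orthogonal_singleton_iff_inner_right, inner_sub_right, real_inner_smul_right,
      real_inner_self_eq_norm_sq, hω]
    ring
  rw [slice, ← integral_add_left_eq_self (fun y : (ℝ ∙ ω)ᗮ => u (⟪ω, a⟫ • ω + (y : V)))
    (⟨a - ⟪ω, a⟫ • ω, ha⟩ : (ℝ ∙ ω)ᗮ)]
  refine integral_congr_ae (Filter.Eventually.of_forall fun y => ?_)
  simp only [Submodule.coe_add]
  congr 1
  abel

/-- The derivatives of order `k` across the hyperplane of the cone integrals `∫ t⁻¹ u(a + tξ) dt`,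
integrated over the directions of the hyperplane. The weight `t⁻¹ t^k = t^{k-1}` is the polar
density, if `k` is the dimension of the hyperplane. -/
lemma IsTestFunction.integral_iteratedDeriv_cone {u : V → F} (hu : IsTestFunction u) {ω a : V}
    (hω : ‖ω‖ = 1) (ha : a ∉ tsupport u) {k : ℕ} (hk : Module.finrank ℝ (ℝ ∙ ω)ᗮ = k + 1) :
    ∫ θ : Metric.sphere (0 : (ℝ ∙ ω)ᗮ) 1,
        iteratedDeriv (k + 1) (fun q : ℝ => ∫ t in Ioi (0 : ℝ),
          t⁻¹ • u (a + t • (((θ : (ℝ ∙ ω)ᗮ) : V) + q • ω))) 0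
        ∂((volume : Measure (ℝ ∙ ω)ᗮ).toSphere) =
      slice ω ((_root_.dirDeriv ω)^[k + 1] u) ⟪ω, a⟫ := by
  have : Nontrivial (ℝ ∙ ω)ᗮ := Module.nontrivial_of_finrank_pos (R := ℝ) (by omega)
  have hd := hu.iterate_dirDeriv ω (k + 1)
  rw [← integral_translate_eq_slice ω hω, integral_eq_integral_sphere volume
    (hd.integrable_slice ω a)]
  refine integral_congr_ae (Filter.Eventually.of_forall fun θ => ?_)
  simp only
  obtain ⟨α, β, hα, hαβ, hI⟩ := exists_Icc_of_notMem hu.hasCompactSupport ha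
  -- Away from `t = 0` and `t = ∞` the weight `t⁻¹` is harmless under differentiation.
  have hw : ContinuousOn (fun t : ℝ => t⁻¹) (uIcc α β) := by
    refine continuousOn_inv₀.mono fun t ht => ?_
    rw [uIcc_of_le hαβ] at ht
    exact (hα.trans_le ht.1).ne'
  have h1 : (fun q : ℝ => ∫ t in Ioi (0 : ℝ),
        t⁻¹ • u (a + t • (((θ : (ℝ ∙ ω)ᗮ) : V) + q • ω))) =ᶠ[nhds 0]
      fun q : ℝ => ∫ t in α..β, t⁻¹ • u (a + t • (((θ : (ℝ ∙ ω)ᗮ) : V) + q • ω)) := by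
    filter_upwards [Metric.ball_mem_nhds (0 : ℝ) one_pos] with q hq
    rw [Metric.mem_ball, dist_zero_right, Real.norm_eq_abs] at hq
    obtain ⟨hl, hr⟩ := norm_add_smul_mem_Icc hω θ hq
    exact setIntegral_Ioi_eq_intervalIntegral hα hαβ fun t ht => hI t _ ht hl hr
  have h2 : ∀ t : ℝ, 0 < t → a + t • ((θ : (ℝ ∙ ω)ᗮ) : V) ∈
      tsupport ((_root_.dirDeriv ω)^[k + 1] u) → t ∈ Ioc α β := by
    intro t ht hm
    obtain ⟨hl, hr⟩ := norm_add_smul_mem_Icc hω θ (q := 0) (by simp)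
    rw [zero_smul, add_zero] at hl hr
    exact hI t _ ht hl hr (tsupport_iterate_dirDeriv_subset ω u _ hm)
  rw [h1.iteratedDeriv_eq, hu.iteratedDeriv_integral hw, hk, Nat.add_sub_cancel]
  simp only [zero_smul, add_zero, Submodule.coe_smul]
  rw [setIntegral_Ioi_eq_intervalIntegral hα hαβ h2]
  refine intervalIntegral.integral_congr fun t ht => ?_
  rw [uIcc_of_le hαβ] at ht
  have ht0 : t ≠ 0 := (hα.trans_le ht.1).ne'
  rw [pow_succ', inv_mul_cancel_left₀ ht0]

end Cone

/-! ### The cone vectors of the data -/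

section ConeVector

variable {n : ℕ} {B γ : Set (Rn n)} {f : Rn n → Rn n} {ang : Sn n → Fin (n - 1) → ℝ}

lemma IsSmoothFieldSupportedIn.isTestFunction (hf : IsSmoothFieldSupportedIn f B) :
    IsTestFunction f := ⟨hf.smooth, hf.compactSupport⟩

lemma IsSmoothFieldSupportedIn.eq_zero (hf : IsSmoothFieldSupportedIn f B) {x : Rn n}
    (hx : x ∉ B) : f x = 0 :=
  image_eq_zero_of_notMem_tsupport fun h => hx (hf.support_subset h)

lemma IsTestFunction.integrable_line (hf : IsTestFunction f) (a : Rn n) {ξ : Rn n} (hξ : ξ ≠ 0) :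
    Integrable fun t : ℝ => f (a + t • ξ) := by
  have hc := hf.continuous
  refine Continuous.integrable_of_hasCompactSupport (by fun_prop) ?_
  exact hf.hasCompactSupport.comp_isClosedEmbedding (g := fun t : ℝ => a + t • ξ)
    ((Homeomorph.addLeft a).isClosedEmbedding.comp (isClosedEmbedding_smul_left hξ))

/-- The half-line field of the data is, up to a multiple of `ξ`, the integral of `f` over the
half-line: the frame only loses the longitudinal component, and as `γ` encompasses `B`, the integral
over a line reduces to that over one of its halves. -/
lemma exists_halfLineField_eq (h_enc : Encompasses γ B)
    (h_ang : ∀ ξ : Sn n, IsSphericalCoordinates ξ (ang ξ)) (hf : IsSmoothFieldSupportedIn f B)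
    (a : γ) {ξ : Rn n} (hξ : ξ ≠ 0) :
    ∃ c : ℝ, halfLineField B ang (restrictedData γ ang f) a ξ =
      (∫ t in Ioi (0 : ℝ), f (a + t • ξ)) - c • ξ := by
  rw [halfLineField, dif_pos hξ]
  split_ifs with hray
  · set η := unitDirection ξ hξ with hη
    set X := ∫ t in Ioi (0 : ℝ), f (a + t • ξ) with hX
    have hη' : (η : Rn n) = ‖ξ‖⁻¹ • ξ := rfl
    have hη0 : (η : Rn n) ≠ 0 := by simp [hη', hξ]
    -- The half-line `t ≤ 0` misses `B`, as the half-line `t ≥ 0` meets it.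
    have hXl : ∫ t : ℝ, f (a + t • ξ) = X := by
      refine (setIntegral_eq_integral_of_forall_compl_eq_zero fun t ht => ?_).symm
      refine hf.eq_zero fun hB => h_enc.2 a a.2 ξ hξ ⟨hray, ?_⟩
      exact ⟨_, ⟨-t, by simpa using ht, by simp⟩, hB⟩
    have hY : ∫ t : ℝ, f (a + t • (η : Rn n)) = ‖ξ‖ • X := by
      have h := Measure.integral_comp_mul_right (fun t : ℝ => f (a + t • ξ)) ‖ξ‖⁻¹
      rw [hXl, inv_inv, abs_of_nonneg (norm_nonneg ξ)] at h
      rw [← h]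
      simp only [hη', smul_smul]
    have hT : ∀ i, restrictedData γ ang f a η i = ⟪‖ξ‖ • X, frameVector (ang η) i⟫ := by
      intro i
      rw [← hY, real_inner_comm, ← integral_inner (hf.isTestFunction.integrable_line a hη0)]
      simp only [restrictedData, transverseRay, real_inner_comm (frameVector (ang η) i)]
    simp only [hT]
    rw [sum_inner_frameVector_smul (h_ang η), smul_sub, smul_smul,
      inv_mul_cancel₀ (norm_ne_zero_iff.2 hξ), one_smul, hη', smul_smul, smul_smul]
    exact ⟨_, rfl⟩
  · refine ⟨0, ?_⟩
    rw [zero_smul, sub_zero, eq_comm]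
    refine setIntegral_eq_zero_of_forall_eq_zero fun t ht => ?_
    refine hf.eq_zero fun hB => hray ⟨_, ⟨t, le_of_lt ht, rfl⟩, hB⟩

/-- The field `⟨ω, y - a⟩ f(y) - ⟨ω, f(y)⟩ (y - a)`. Its integrals over the half-lines from `a`,
with the weight `t⁻¹`, are the functions differentiated in `coneVector`. -/
noncomputable def coneDensity (f : Rn n → Rn n) (ω a y : Rn n) : Rn n :=
  (⟪ω, y⟫ - ⟪ω, a⟫) • f y - ⟪ω, f y⟫ • (y - a)

lemma halfLineField_combination_eq (h_enc : Encompasses γ B)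
    (h_ang : ∀ ξ : Sn n, IsSphericalCoordinates ξ (ang ξ)) (hf : IsSmoothFieldSupportedIn f B)
    (a : γ) (ω ξ : Rn n) :
    ⟪ω, ξ⟫ • halfLineField B ang (restrictedData γ ang f) a ξ -
        ⟪ω, halfLineField B ang (restrictedData γ ang f) a ξ⟫ • ξ =
      ∫ t in Ioi (0 : ℝ), t⁻¹ • coneDensity f ω a (a + t • ξ) := by
  by_cases hξ : ξ = 0
  -- For `ξ = 0` both sides vanish: `coneDensity f ω a` is `0` at `a`.
  · subst hξ
    simp [coneDensity]
  obtain ⟨c, hc⟩ := exists_halfLineField_eq h_enc h_ang hf a hξ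
  have hint := (hf.isTestFunction.integrable_line (a : Rn n) hξ).integrableOn (s := Ioi 0)
  have h1 : ∫ t in Ioi (0 : ℝ), t⁻¹ • coneDensity f ω a (a + t • ξ) =
      ∫ t in Ioi (0 : ℝ), (⟪ω, ξ⟫ • f (a + t • ξ) - ⟪ω, f (a + t • ξ)⟫ • ξ) := by
    refine setIntegral_congr_fun measurableSet_Ioi fun t ht => ?_
    have ht' : t ≠ 0 := (mem_Ioi.1 ht).ne'
    simp only [coneDensity, inner_add_right, real_inner_smul_right, add_sub_cancel_left, smul_sub,
      smul_smul, inv_mul_cancel_left₀ ht']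
    congr 2
    field_simp
  rw [h1, integral_sub (f := fun t => ⟪ω, ξ⟫ • f (a + t • ξ)) (hint.smul ⟪ω, ξ⟫)
      ((hint.const_inner ω).smul_const ξ), integral_smul, integral_smul_const,
    integral_inner hint, hc, inner_sub_right, real_inner_smul_right]
  module

lemma isTestFunction_coneDensity (hf : IsTestFunction f) (ω a : Rn n) :
    IsTestFunction (coneDensity f ω a) :=
  (hf.smul (((innerSL ℝ ω).contDiff).sub contDiff_const)).sub
    ((hf.inner_left ω).smul_right (contDiff_id.sub contDiff_const))

lemma tsupport_coneDensity_subset (f : Rn n → Rn n) (ω a : Rn n) :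
    tsupport (coneDensity f ω a) ⊆ tsupport f := by
  refine closure_mono fun y hy => ?_
  contrapose! hy
  simp only [Function.mem_support, not_not] at hy ⊢
  simp [coneDensity, hy]

lemma finrank_orthogonal_span {k : ℕ} (hk : n = k + 2) {ω : Rn n} (hω : ω ≠ 0) :
    Module.finrank ℝ (ℝ ∙ ω)ᗮ = k + 1 := by
  have h := (ℝ ∙ ω).finrank_add_finrank_orthogonal
  rw [finrank_span_singleton hω, finrank_euclideanSpace_fin] at h
  omega

lemma coneVector_eq_slice_coneDensity {k : ℕ} (hk : n = k + 2) (h_enc : Encompasses γ B)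
    (h_ang : ∀ ξ : Sn n, IsSphericalCoordinates ξ (ang ξ)) (hf : IsSmoothFieldSupportedIn f B)
    (a : γ) (ω : Sn n) :
    coneVector B ang (restrictedData γ ang f) a ω =
      slice (ω : Rn n) ((dirDeriv (ω : Rn n))^[k + 1] (coneDensity f ω a))
        ⟪(ω : Rn n), (a : Rn n)⟫ := by
  have hω : ‖(ω : Rn n)‖ = 1 := norm_eq_of_mem_sphere ω
  have ha : (a : Rn n) ∉ tsupport (coneDensity f ω a) := fun h => by
    have : (a : Rn n) ∈ γ ∩ B :=
      ⟨a.2, hf.support_subset (tsupport_coneDensity_subset f _ _ h)⟩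
    rw [h_enc.1] at this
    exact this
  rw [← (isTestFunction_coneDensity hf.isTestFunction _ _).integral_iteratedDeriv_cone hω ha
    (finrank_orthogonal_span hk (by rw [← norm_ne_zero_iff, hω]; exact one_ne_zero)), coneVector]
  simp only [halfLineField_combination_eq h_enc h_ang hf]
  rw [show n - 1 = k + 1 by omega]

/-- The density `(n-1) ∂_ω^{n-2} f - ∂_ω^{n-1} (⟨ω, f⟩ y)`, with `k = n - 2`; its integral over a
hyperplane is the part of the cone vector that does not depend on the vertex of the cone. -/
noncomputable def vertexFreeDensity (f : Rn n → Rn n) (k : ℕ) (ω y : Rn n) : Rn n :=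
  ((k : ℝ) + 1) • (dirDeriv ω)^[k] f y - (dirDeriv ω)^[k + 1] (fun y => ⟪ω, f y⟫ • y) y

lemma isTestFunction_vertexFreeDensity (hf : IsTestFunction f) (k : ℕ) (ω : Rn n) :
    IsTestFunction (vertexFreeDensity f k ω) :=
  ((hf.iterate_dirDeriv ω k).smul contDiff_const).sub
    (((hf.inner_left ω).smul_right contDiff_id).iterate_dirDeriv ω (k + 1))

/-- The cone vector is affine in the vertex of the cone. -/
lemma coneVector_eq {k : ℕ} (hk : n = k + 2) (h_enc : Encompasses γ B)
    (h_ang : ∀ ξ : Sn n, IsSphericalCoordinates ξ (ang ξ)) (hf : IsSmoothFieldSupportedIn f B)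
    (a : γ) (ω : Sn n) {p : ℝ} (ha : (a : Rn n) ∈ hyperplane (ω : Rn n) p) :
    coneVector B ang (restrictedData γ ang f) a ω =
      slice (ω : Rn n) (vertexFreeDensity f k ω) p +
        slice (ω : Rn n) ((dirDeriv (ω : Rn n))^[k + 1] fun y => ⟪(ω : Rn n), f y⟫) p •
          (a : Rn n) := by
  have hω : ‖(ω : Rn n)‖ = 1 := norm_eq_of_mem_sphere ω
  have ha' : ⟪(ω : Rn n), (a : Rn n)⟫ = p := ha
  have ht := hf.isTestFunction
  have h1 : IsTestFunction fun y => ⟪(ω : Rn n), f y⟫ := ht.inner_left _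
  have h2 : IsTestFunction fun y => ⟪(ω : Rn n), f y⟫ • y := h1.smul_right contDiff_id
  have h3 : IsTestFunction fun y => ⟪(ω : Rn n), f y⟫ • (a : Rn n) := h1.smul_right contDiff_const
  have h4 : IsTestFunction fun y => (⟪(ω : Rn n), y⟫ - p) • f y :=
    ht.smul (((innerSL ℝ (ω : Rn n)).contDiff).sub contDiff_const)
  have h5 : coneDensity f ω a = fun y =>
      ((⟪(ω : Rn n), y⟫ - p) • f y - ⟪(ω : Rn n), f y⟫ • y) + ⟪(ω : Rn n), f y⟫ • (a : Rn n) := by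
    ext1 y
    rw [coneDensity, ha', smul_sub]
    abel
  have h6 := h1.iterate_dirDeriv_clm (ContinuousLinearMap.toSpanSingleton ℝ (a : Rn n))
    (ω : Rn n) (k + 1)
  simp only [ContinuousLinearMap.toSpanSingleton_apply] at h6
  rw [coneVector_eq_slice_coneDensity hk h_enc h_ang hf, ha', h5,
    (h4.sub h2).iterate_dirDeriv_add h3, h4.iterate_dirDeriv_sub h2, h6,
    ht.iterate_dirDeriv_affine_smul hω]
  simp only [slice]
  rw [← integral_smul_const, ← integral_add]
  · refine integral_congr_ae (Filter.Eventually.of_forall fun y => ?_)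
    have hy : ⟪(ω : Rn n), (y : Rn n)⟫ = 0 :=
      Submodule.mem_orthogonal_singleton_iff_inner_right.1 y.2
    have hp : ⟪(ω : Rn n), p • (ω : Rn n) + (y : Rn n)⟫ - p = 0 := by
      rw [inner_add_right, real_inner_smul_right, hy, real_inner_self_eq_norm_sq, hω]
      ring
    simp only [hp, zero_smul, zero_add, vertexFreeDensity]
  · exact (isTestFunction_vertexFreeDensity ht k _).integrable_slice _ _
  · exact ((h1.iterate_dirDeriv _ (k + 1)).integrable_slice _ _).smul_const _

lemma slice_eq_zero {F : Type*} [NormedAddCommGroup F] [NormedSpace ℝ F] {u : Rn n → F}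
    (hu : tsupport u ⊆ B) {ω : Rn n} (hω : ‖ω‖ = 1) {p : ℝ}
    (h : ¬(hyperplane ω p ∩ B).Nonempty) : slice ω u p = 0 := by
  refine integral_eq_zero_of_ae (Filter.Eventually.of_forall fun y => ?_)
  refine image_eq_zero_of_notMem_tsupport fun hm => h ⟨_, ?_, hu hm⟩
  have hy : ⟪ω, (y : Rn n)⟫ = 0 := Submodule.mem_orthogonal_singleton_iff_inner_right.1 y.2
  rw [hyperplane, mem_ofPred_eq, inner_add_right, real_inner_smul_right, hy,
    real_inner_self_eq_norm_sq, hω]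
  ring

lemma tsupport_subset_of_eq_zero {F G : Type*} [Zero F] [Zero G] {f : Rn n → F} {u : Rn n → G}
    (h : ∀ y, f y = 0 → u y = 0) : tsupport u ⊆ tsupport f :=
  closure_mono fun y hy hf => hy (h y hf)

/-- If the hyperplane `H_{ω,p}` meets `B`, the chosen points `c₁`, `c₂` are two different points of
it. This is all that the weights need of the choice. -/
def IsProperAt (B : Set (Rn n)) (c₁ c₂ : Sn n × ℝ → γ) (ω : Sn n) (p : ℝ) : Prop :=
  (hyperplane (ω : Rn n) p ∩ B).Nonempty →
    (c₁ (ω, p) : Rn n) ∈ hyperplane (ω : Rn n) p ∧ (c₂ (ω, p) : Rn n) ∈ hyperplane (ω : Rn n) p ∧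
      (c₁ (ω, p) : Rn n) ≠ c₂ (ω, p)

lemma scalarWeight_eq {k : ℕ} (hk : n = k + 2) (h_enc : Encompasses γ B)
    (h_ang : ∀ ξ : Sn n, IsSphericalCoordinates ξ (ang ξ)) (hf : IsSmoothFieldSupportedIn f B)
    {c₁ c₂ : Sn n × ℝ → γ} {ω : Sn n} {p : ℝ} (hc : IsProperAt B c₁ c₂ ω p) :
    scalarWeight B ang c₁ c₂ (restrictedData γ ang f) ω p =
      slice (ω : Rn n) ((dirDeriv (ω : Rn n))^[k + 1] fun y => ⟪(ω : Rn n), f y⟫) p := by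
  rw [scalarWeight]
  split_ifs with h
  · obtain ⟨h1, h2, h3⟩ := hc h
    rw [coneVector_eq hk h_enc h_ang hf _ _ h1, coneVector_eq hk h_enc h_ang hf _ _ h2,
      add_sub_add_left_eq_sub, ← smul_sub, real_inner_smul_left, real_inner_self_eq_norm_sq,
      mul_div_cancel_right₀]
    exact pow_ne_zero 2 (norm_ne_zero_iff.2 (sub_ne_zero.2 h3))
  · refine (slice_eq_zero (((tsupport_iterate_dirDeriv_subset _ _ _).trans
      (tsupport_subset_of_eq_zero (f := f) ?_)).trans hf.support_subset)
      (norm_eq_of_mem_sphere ω) h).symm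
    intro y hy
    simp [hy]

/-- The density of `vectorWeight`, as a derivative of order `n - 2`. -/
lemma inner_vertexFreeDensity (hf : IsTestFunction f) (k : ℕ) (ω v : Rn n) :
    (fun y => ⟪v, vertexFreeDensity f k ω y⟫) = (dirDeriv ω)^[k] fun y =>
      ((k : ℝ) + 1) * ⟪v, f y⟫ - dirDeriv ω (fun y => ⟪ω, ⟪v, y⟫ • f y⟫) y := by
  have h1 : IsTestFunction fun y => ⟪ω, f y⟫ • y := (hf.inner_left ω).smul_right contDiff_id
  have h2 : IsTestFunction fun y => ⟪ω, ⟪v, y⟫ • f y⟫ :=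
    (hf.smul (innerSL ℝ v).contDiff).inner_left ω
  have h3 : IsTestFunction fun y => ((k : ℝ) + 1) * ⟪v, f y⟫ :=
    (hf.inner_left v).smul contDiff_const
  have h4 := hf.iterate_dirDeriv_clm (((k : ℝ) + 1) • innerSL ℝ v) ω k
  have h5 := h1.iterate_dirDeriv_clm (innerSL ℝ v) ω (k + 1)
  simp only [_root_.smul_apply, innerSL_apply_apply, smul_eq_mul] at h4 h5
  have h6 : (fun y => ⟪ω, ⟪v, y⟫ • f y⟫) = fun y => ⟪v, ⟪ω, f y⟫ • y⟫ := by
    ext y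
    rw [real_inner_smul_right, real_inner_smul_right, mul_comm]
  rw [h3.iterate_dirDeriv_sub (h2.dirDeriv ω), h4, ← Function.iterate_succ_apply, h6, h5]
  ext y
  rw [vertexFreeDensity, inner_sub_right, real_inner_smul_right]

lemma vectorWeight_eq {k : ℕ} (hk : n = k + 2) (h_enc : Encompasses γ B)
    (h_ang : ∀ ξ : Sn n, IsSphericalCoordinates ξ (ang ξ)) (hf : IsSmoothFieldSupportedIn f B)
    {c₁ c₂ : Sn n × ℝ → γ} {ω : Sn n} {p : ℝ} (hc : IsProperAt B c₁ c₂ ω p) (v : Rn n) :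
    vectorWeight B ang c₁ c₂ (restrictedData γ ang f) v ω p =
      slice (ω : Rn n) ((dirDeriv (ω : Rn n))^[k] fun y =>
        ((k : ℝ) + 1) * ⟪v, f y⟫ -
          dirDeriv (ω : Rn n) (fun y => ⟪(ω : Rn n), ⟪v, y⟫ • f y⟫) y) p := by
  have ht := hf.isTestFunction
  rw [← inner_vertexFreeDensity ht]
  by_cases h : (hyperplane (ω : Rn n) p ∩ B).Nonempty
  · rw [vectorWeight, if_pos h, scalarWeight_eq hk h_enc h_ang hf hc,
      coneVector_eq hk h_enc h_ang hf _ _ (hc h).1, add_sub_cancel_right, real_inner_comm, slice,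
      ← integral_inner ((isTestFunction_vertexFreeDensity ht k _).integrable_slice _ _), slice]
  · rw [vectorWeight, if_neg h]
    refine (slice_eq_zero (Subset.trans ?_ hf.support_subset) (norm_eq_of_mem_sphere ω) h).symm
    rw [inner_vertexFreeDensity ht]
    refine (tsupport_iterate_dirDeriv_subset _ _ _).trans fun y hy => ?_
    by_contra hcon
    have h0 : f =ᶠ[nhds y] 0 := notMem_tsupport_iff_eventuallyEq.1 hcon
    refine notMem_tsupport_iff_eventuallyEq.2 ?_ hy
    filter_upwards [h0, h0.eventuallyEq_nhds] with z hz hz'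
    have h1 : (fun y => ⟪(ω : Rn n), ⟪v, y⟫ • f y⟫) =ᶠ[nhds z] fun _ => 0 := by
      filter_upwards [hz'] with w hw
      simp [hw]
    simp [hz, dirDeriv, h1.fderiv_eq]

end ConeVector

/-! ### The points on the hyperplanes -/

section PointChoice

variable {n : ℕ} {B γ : Set (Rn n)}

/-- A hyperplane that meets the open set `B` meets it in a set of positive volume. -/
lemma euclideanHausdorffMeasure_hyperplane_inter_ne_zero (hB : IsOpen B) {ω : Rn n}
    (hω : ‖ω‖ = 1) {p : ℝ} (h : (hyperplane ω p ∩ B).Nonempty) :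
    (Measure.euclideanHausdorffMeasure (n - 1) : Measure (Rn n)) (hyperplane ω p ∩ B) ≠ 0 := by
  obtain ⟨x, hx, hxB⟩ := h
  have hE : Module.finrank ℝ (ℝ ∙ ω)ᗮ = n - 1 := by
    have h := (ℝ ∙ ω).finrank_add_finrank_orthogonal
    rw [finrank_span_singleton (by rw [← norm_ne_zero_iff, hω]; exact one_ne_zero),
      finrank_euclideanSpace_fin] at h
    omega
  let e : (ℝ ∙ ω)ᗮ → Rn n := fun y => x + (y : Rn n)
  have he : Isometry e := (isometry_add_left x).comp isometry_subtype_coe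
  have hpos : volume (e ⁻¹' B) ≠ 0 :=
    ((hB.preimage he.continuous).measure_pos volume ⟨0, by simpa [e] using hxB⟩).ne'
  rw [← InnerProductSpace.euclideanHausdorffMeasure_eq_volume, hE,
    he.euclideanHausdorffMeasure_preimage] at hpos
  refine fun h0 => hpos (measure_mono_null ?_ h0)
  rintro _ ⟨hB', y, rfl⟩
  refine ⟨?_, hB'⟩
  have hy : ⟪ω, (y : Rn n)⟫ = 0 := Submodule.mem_orthogonal_singleton_iff_inner_right.1 y.2
  have hx' : ⟪ω, x⟫ = p := hx
  simp [e, hyperplane, inner_add_right, hy, hx']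

lemma IndependentOnSlice.exists_linearIndependent (hB : IsOpen B) {ω : Rn n} (hω : ‖ω‖ = 1) {p : ℝ}
    (h : (hyperplane ω p ∩ B).Nonempty) {a b : Rn n} (hab : IndependentOnSlice B ω p a b) :
    ∃ x ∈ hyperplane ω p, LinearIndependent ℝ ![x - a, x - b] := by
  have hm : MeasurableSet (hyperplane ω p ∩ B) :=
    (measurableSet_eq_fun (by fun_prop) measurable_const).inter hB.measurableSet
  have hne : (Measure.euclideanHausdorffMeasure (n - 1) : Measure (Rn n)).restrict
      (hyperplane ω p ∩ B) ≠ 0 := by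
    rw [Ne, Measure.restrict_eq_zero]
    exact euclideanHausdorffMeasure_hyperplane_inter_ne_zero hB hω h
  have : (ae ((Measure.euclideanHausdorffMeasure (n - 1) : Measure (Rn n)).restrict
      (hyperplane ω p ∩ B))).NeBot := ae_neBot.2 hne
  obtain ⟨x, hx, hxm⟩ := (Filter.Eventually.and hab (ae_restrict_mem hm)).exists
  exact ⟨x, hxm.1, hx⟩

lemma IndependentOnSlice.ne (hB : IsOpen B) {ω : Rn n} (hω : ‖ω‖ = 1) {p : ℝ}
    (h : (hyperplane ω p ∩ B).Nonempty) {a b : Rn n} (hab : IndependentOnSlice B ω p a b) :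
    a ≠ b := by
  obtain ⟨x, -, hx⟩ := hab.exists_linearIndependent hB hω h
  rintro rfl
  have := hx.injective (a₁ := 0) (a₂ := 1) (by simp)
  simp at this

/-- Two independent vectors parallel to a hyperplane of `ℝⁿ` need `n ≥ 3`. -/
lemma IndependentOnSlice.three_le (hB : IsOpen B) {ω : Rn n} (hω : ‖ω‖ = 1) {p : ℝ}
    (h : (hyperplane ω p ∩ B).Nonempty) {a b : Rn n} (hab : IndependentOnSlice B ω p a b)
    (ha : a ∈ hyperplane ω p) (hb : b ∈ hyperplane ω p) : 3 ≤ n := by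
  obtain ⟨x, hx, hi⟩ := hab.exists_linearIndependent hB hω h
  have hmem : ∀ c ∈ hyperplane ω p, x - c ∈ (ℝ ∙ ω)ᗮ := by
    intro c hc
    rw [Submodule.mem_orthogonal_singleton_iff_inner_right, inner_sub_right]
    exact sub_eq_zero.2 (Eq.trans hx (Eq.symm hc))
  have h1 : Submodule.span ℝ (range ![x - a, x - b]) ≤ (ℝ ∙ ω)ᗮ := by
    rw [Submodule.span_le]
    rintro _ ⟨i, rfl⟩
    fin_cases i
    · exact hmem a ha
    · exact hmem b hb
  have h2 := Submodule.finrank_mono h1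
  rw [finrank_span_eq_card hi, Fintype.card_fin] at h2
  have h3 := (ℝ ∙ ω).finrank_add_finrank_orthogonal
  rw [finrank_span_singleton (by rw [← norm_ne_zero_iff, hω]; exact one_ne_zero),
    finrank_euclideanSpace_fin] at h3
  omega

instance isOpenPosMeasure_hyperplaneMeasure : (hyperplaneMeasure n).IsOpenPosMeasure := by
  unfold hyperplaneMeasure
  infer_instance

/-- A property of almost all hyperplanes holds for one that meets the nonempty open set `B`. -/
lemma exists_hyperplane_of_ae (hn : 0 < n) (hB : IsOpen B) (hne : B.Nonempty)
    {P : Sn n × ℝ → Prop} (hP : ∀ᵐ h ∂(hyperplaneMeasure n), P h) :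
    ∃ h, P h ∧ (hyperplane (h.1 : Rn n) h.2 ∩ B).Nonempty := by
  obtain ⟨x, hx⟩ := hne
  have : Nonempty (Fin n) := ⟨⟨0, hn⟩⟩
  obtain ⟨ω₀, hω₀⟩ := (NormedSpace.sphere_nonempty (E := Rn n) (x := 0) (r := 1)).2 zero_le_one
  -- `m (ω, p)` is the projection of `x` to `H_{ω,p}`.
  let m : Sn n × ℝ → Rn n := fun h => x + (h.2 - ⟪(h.1 : Rn n), x⟫) • (h.1 : Rn n)
  have hm : Continuous m := by fun_prop
  have hU : (m ⁻¹' B).Nonempty := ⟨(⟨ω₀, hω₀⟩, ⟪ω₀, x⟫), by simpa [m] using hx⟩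
  have hpos := (hB.preimage hm).measure_ne_zero (hyperplaneMeasure n) hU
  obtain ⟨h, hhU, hh⟩ : ∃ h ∈ m ⁻¹' B, P h := by
    by_contra! hcon
    exact hpos (measure_mono_null (fun h hh => hcon h hh) (ae_iff.1 hP))
  refine ⟨h, hh, m h, ?_, hhU⟩
  have h1 : ‖(h.1 : Rn n)‖ = 1 := norm_eq_of_mem_sphere h.1
  rw [hyperplane, mem_ofPred_eq]
  simp only [m]
  rw [inner_add_right, real_inner_smul_right, real_inner_self_eq_norm_sq, h1]
  ring

lemma ModifiedKirillovTuy.ae_exists_points (h : ModifiedKirillovTuy γ B) :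
    ∀ᵐ h ∂(hyperplaneMeasure n), (hyperplane (h.1 : Rn n) h.2 ∩ B).Nonempty →
      ∃ c : γ × γ, (c.1 : Rn n) ∈ hyperplane (h.1 : Rn n) h.2 ∧
        (c.2 : Rn n) ∈ hyperplane (h.1 : Rn n) h.2 ∧ IndependentOnSlice B h.1 h.2 c.1 c.2 := by
  filter_upwards [h] with h hh hne
  obtain ⟨U, c₁, c₂, -, hU, -, -, hc, hi⟩ := hh hne
  obtain ⟨h1, h2⟩ := hc _ hU (norm_eq_of_mem_sphere h.1)
  exact ⟨(⟨_, h1.2⟩, ⟨_, h2.2⟩), h1.1, h2.1, hi⟩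

lemma ModifiedKirillovTuy.three_le_and_nonempty (hn : 0 < n) (hB : IsOpen B) (hne : B.Nonempty)
    (h : ModifiedKirillovTuy γ B) : 3 ≤ n ∧ Nonempty γ := by
  obtain ⟨h, hP, hh⟩ := exists_hyperplane_of_ae hn hB hne h.ae_exists_points
  obtain ⟨c, h1, h2, h3⟩ := hP hh
  exact ⟨h3.three_le hB (norm_eq_of_mem_sphere h.1) hh h1 h2, ⟨c.1⟩⟩

lemma ModifiedKirillovTuy.exists_isPointChoice [Nonempty γ] (h : ModifiedKirillovTuy γ B) :
    ∃ c₁ c₂ : Sn n × ℝ → γ, IsPointChoice γ B c₁ c₂ := by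
  classical
  let Q : Sn n × ℝ → γ × γ → Prop := fun h c => (c.1 : Rn n) ∈ hyperplane (h.1 : Rn n) h.2 ∧
    (c.2 : Rn n) ∈ hyperplane (h.1 : Rn n) h.2 ∧ IndependentOnSlice B h.1 h.2 c.1 c.2
  have hQ : ∀ h, ∃ c, (∃ c', Q h c') → Q h c := by
    intro h
    by_cases hc : ∃ c', Q h c'
    · exact ⟨hc.choose, fun _ => hc.choose_spec⟩
    · exact ⟨Classical.arbitrary _, fun h' => absurd h' hc⟩
  choose c hc using hQ
  refine ⟨fun h => (c h).1, fun h => (c h).2, ?_⟩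
  filter_upwards [h.ae_exists_points] with h hh hne
  exact hc h (hh hne)

lemma IsPointChoice.ae_isProperAt (hB : IsOpen B) {c₁ c₂ : Sn n × ℝ → γ}
    (h : IsPointChoice γ B c₁ c₂) :
    ∀ᵐ ω ∂((volume : Measure (Rn n)).toSphere), ∀ᵐ p : ℝ, IsProperAt B c₁ c₂ ω p := by
  refine Measure.ae_ae_of_ae_prod (p := fun h => IsProperAt B c₁ c₂ h.1 h.2) ?_
  filter_upwards [h] with h hh hne
  obtain ⟨h1, h2, h3⟩ := hh hne
  exact ⟨h1, h2, h3.ne hB (norm_eq_of_mem_sphere h.1) hne⟩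

end PointChoice

/-! ### The reconstruction formula -/

section Reconstruction

variable {n : ℕ} {B γ : Set (Rn n)} {f : Rn n → Rn n} {ang : Sn n → Fin (n - 1) → ℝ}
  {c₁ c₂ : Sn n × ℝ → γ}

/-- The weight `W₀` is the derivative of order `n - 2` of the Radon transform of `div f`. -/
lemma radonInversion_scalarWeight (hn : 2 ≤ n) (hB : IsOpen B) (h_enc : Encompasses γ B)
    (h_ang : ∀ ξ : Sn n, IsSphericalCoordinates ξ (ang ξ)) (hc : IsPointChoice γ B c₁ c₂)
    (hf : IsSmoothFieldSupportedIn f B) (x : Rn n) :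
    radonInversion (n - 2) (scalarWeight B ang c₁ c₂ (restrictedData γ ang f)) x =
      divergence f x := by
  have ht := hf.isTestFunction
  refine radonInversion_eq (by omega) _ ht.divergence ?_ x
  filter_upwards [hc.ae_isProperAt hB] with ω hω s _
  have hω1 : ‖(ω : Rn n)‖ = 1 := norm_eq_of_mem_sphere ω
  have hu := ht.inner_left (ω : Rn n)
  rw [ht.realFourier_divergence, ← mul_assoc, ← pow_succ,
    ← hu.realFourier_iterate_dirDeriv hω1, ← (hu.iterate_dirDeriv _ _).integral_exp_mul_slice hω1]
  refine integral_congr_ae ?_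
  filter_upwards [hω] with p hp
  rw [scalarWeight_eq (k := n - 2) (by omega) h_enc h_ang hf hp]

/-- The weight `W_v` is the derivative of order `n - 2` of the Radon transform of
`(n - 1) ⟨v, f⟩ - div (⟨v, x⟩ f) = (n - 2) ⟨v, f⟩ - ⟨v, x⟩ div f`. -/
lemma radonInversion_vectorWeight (hn : 2 ≤ n) (hB : IsOpen B) (h_enc : Encompasses γ B)
    (h_ang : ∀ ξ : Sn n, IsSphericalCoordinates ξ (ang ξ)) (hc : IsPointChoice γ B c₁ c₂)
    (hf : IsSmoothFieldSupportedIn f B) (v x : Rn n) :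
    radonInversion (n - 2) (vectorWeight B ang c₁ c₂ (restrictedData γ ang f) v) x =
      ((n : ℝ) - 2) * ⟪v, f x⟫ - ⟪v, x⟫ * divergence f x := by
  have ht := hf.isTestFunction
  have hg : IsTestFunction fun y => ⟪v, y⟫ • f y := ht.smul (innerSL ℝ v).contDiff
  have h1 : IsTestFunction fun y => (((n - 2 : ℕ) : ℝ) + 1) * ⟪v, f y⟫ :=
    (ht.inner_left v).smul contDiff_const
  have h2 := radonInversion_eq (n := n) (by omega) (n - 2)
    (G := vectorWeight B ang c₁ c₂ (restrictedData γ ang f) v) (h1.sub hg.divergence) ?_ x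
  · rw [h2, ht.divergence_inner_smul, Nat.cast_sub hn]
    push_cast
    ring
  filter_upwards [hc.ae_isProperAt hB] with ω hω s _
  have hω1 : ‖(ω : Rn n)‖ = 1 := norm_eq_of_mem_sphere ω
  have hu := (hg.inner_left (ω : Rn n)).dirDeriv (ω : Rn n)
  have h3 : realFourier (divergence fun y => ⟪v, y⟫ • f y) (s • (ω : Rn n)) =
      realFourier (dirDeriv (ω : Rn n) fun y => ⟪(ω : Rn n), ⟪v, y⟫ • f y⟫) (s • (ω : Rn n)) := by
    rw [hg.realFourier_divergence, (hg.inner_left (ω : Rn n)).realFourier_dirDeriv,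
      real_inner_smul_right, real_inner_self_eq_norm_sq, hω1]
    push_cast
    ring
  rw [h1.realFourier_sub hg.divergence, h3, ← h1.realFourier_sub hu,
    ← (h1.sub hu).realFourier_iterate_dirDeriv hω1,
    ← ((h1.sub hu).iterate_dirDeriv _ _).integral_exp_mul_slice hω1]
  refine integral_congr_ae ?_
  filter_upwards [hω] with p hp
  rw [vectorWeight_eq (k := n - 2) (by omega) h_enc h_ang hf hp]

lemma inner_eq_reconstructedComponent (hn : 3 ≤ n) (hB : IsOpen B) (h_enc : Encompasses γ B)
    (h_ang : ∀ ξ : Sn n, IsSphericalCoordinates ξ (ang ξ)) (hc : IsPointChoice γ B c₁ c₂)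
    (hf : IsSmoothFieldSupportedIn f B) (x v : Rn n) :
    ⟪f x, v⟫ = reconstructedComponent B ang c₁ c₂ (restrictedData γ ang f) v x := by
  have hn' : (n : ℝ) - 2 ≠ 0 := by
    have : (3 : ℝ) ≤ n := by exact_mod_cast hn
    linarith
  rw [reconstructedComponent, radonInversion_vectorWeight (by omega) hB h_enc h_ang hc hf,
    radonInversion_scalarWeight (by omega) hB h_enc h_ang hc hf, real_inner_comm v x,
    sub_add_cancel, inv_mul_cancel_left₀ hn', real_inner_comm]

end Reconstruction
theorem theorem2p2 (n : ℕ) (hn : 2 ≤ n) (B γ : Set (Rn n))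
    (hB_open : IsOpen B) (hB_conn : IsConnected B) (hB_bdd : Bornology.IsBounded B)
    (h_enc : Encompasses γ B) (h_KT : ModifiedKirillovTuy γ B)
    (ang : Sn n → Fin (n - 1) → ℝ) (h_ang : ∀ ξ : Sn n, IsSphericalCoordinates ξ (ang ξ)) :
    -- uniqueness: the data for all lines meeting the curve determine the field
    (∀ f g : Rn n → Rn n, IsSmoothFieldSupportedIn f B → IsSmoothFieldSupportedIn g B →
      (∀ a ∈ γ, ∀ (ξ : Sn n) (i : Fin (n - 1)),
        transverseRay ang f a ξ i = transverseRay ang g a ξ i) → f = g) ∧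
    -- explicit reconstruction from the data, for any choice of the two points on the hyperplanes
    (∃ c₁ c₂ : Sn n × ℝ → γ, IsPointChoice γ B c₁ c₂) ∧
    (∀ c₁ c₂ : Sn n × ℝ → γ, IsPointChoice γ B c₁ c₂ →
      ∀ f : Rn n → Rn n, IsSmoothFieldSupportedIn f B →
        (∀ x v : Rn n,
          ⟪f x, v⟫ = reconstructedComponent B ang c₁ c₂ (restrictedData γ ang f) v x) ∧
        (∀ (x : Rn n) (ξ₁ ξ₂ : Sn n),
          LinearIndependent ℝ ![(ξ₁ : Rn n), (ξ₂ : Rn n)] →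
          (∃ l : Fin (n - 1), LinearIndependent ℝ (mixedFrame ang ξ₁ ξ₂ l)) ∧
          ∀ l : Fin (n - 1), LinearIndependent ℝ (mixedFrame ang ξ₁ ξ₂ l) →
            ∀ v : Rn n, ⟪f x, v⟫ =
              ∑ j : Fin n, cramerCoefficient (mixedFrame ang ξ₁ ξ₂ l) v j *
                reconstructedComponent B ang c₁ c₂ (restrictedData γ ang f)
                  (mixedFrame ang ξ₁ ξ₂ l j) x)) := by

  have hne := hB_conn.nonempty
  obtain ⟨hn3, hγ⟩ := h_KT.three_le_and_nonempty (by omega) hB_open hne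
  have hrec : ∀ c₁ c₂ : Sn n × ℝ → γ, IsPointChoice γ B c₁ c₂ → ∀ f : Rn n → Rn n,
      IsSmoothFieldSupportedIn f B → ∀ x v : Rn n,
        ⟪f x, v⟫ = reconstructedComponent B ang c₁ c₂ (restrictedData γ ang f) v x :=
    fun c₁ c₂ hc f hf => inner_eq_reconstructedComponent hn3 hB_open h_enc h_ang hc hf
  have hex := h_KT.exists_isPointChoice
  refine ⟨fun f g hf hg hfg => ?_, hex, fun c₁ c₂ hc f hf => ⟨hrec c₁ c₂ hc f hf, ?_⟩⟩
  · obtain ⟨c₁, c₂, hc⟩ := hex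
    have hdata : restrictedData γ ang f = restrictedData γ ang g := by
      funext a ξ i
      exact hfg a a.2 ξ i
    funext x
    refine ext_inner_right ℝ fun v => ?_
    rw [hrec c₁ c₂ hc f hf, hrec c₁ c₂ hc g hg, hdata]
  · intro x ξ₁ ξ₂ hξ
    refine ⟨exists_linearIndependent_mixedFrame hn h_ang hξ, fun l hl v => ?_⟩
    conv_lhs => rw [← sum_cramerCoefficient_smul hl v, inner_sum]
    refine Finset.sum_congr rfl fun j _ => ?_
    rw [real_inner_smul_right, hrec c₁ c₂ hc f hf]
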